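/- **Setting.** Let $N=\mathbb Z^2$, $M=\mathrm{Hom}(N,\mathbb Z)$, $\omega(u,v)=u_1v_2-u_2v_1$, and for an abelian group $G$ let $N_G=N\otimes G=\mathrm{Hom}(M,G)$. Let $\Delta$ be a finite multiset of primitive vectors of $N$ with sum $0$, let $n_1\in N$, and let $s\ge 0$ be an integer such that $n_1$ has multiplicity at least $2s$ in $\Delta$. Put $\Delta(s)=(\Delta\setminus\{n_1^{2s}\})\cup\{(2n_1)^s\}$. A *rational parametrized tropical curve* $(\Gamma,h)$ is a finite metric tree $\Gamma$ whose vertices have valence at least $3$, with bounded edges $\gamma$ of length $|\gamma|$ and with unbounded ends, together with a map $h:\Gamma\to N_{\mathbb R}$ that is affine on each edge, has slopes in $N$ and is balanced at each vertex. As we work over $\mathbb C((t))$, lengths are positive integers and vertices are mapped to $N$. Its degree is the multiset of the slopes $n_e$ of its ends $e$ (oriented toward infinity); the moment of $e$ is $\omega(n_e,p)$ for any $p\in h(e)$. A vertex is *flat* if the slopes of all its adjacent edges lie on a line. A *real structure* is an involutive isometry $\sigma$ of $\Gamma$ with $h\circ\sigma=h$. Vertices, edges and ends are called real if fixed by $\sigma$,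 and there must be a real end $x_r$; all edges are oriented away from $x_r$. We write $\mathfrak t(\gamma),\mathfrak h(\gamma)$ for the tail and head of an edge, $v_j$ for the vertex adjacent to the end $j$, $v_r$ for the one adjacent to $x_r$, $n_\gamma$ for the slope along $\gamma$, and $I_w^\infty$ for the set of ends reached from a vertex $w$ by oriented paths. We say that $(\Gamma,\sigma,h)$ without flat vertex is *obtained from* $(\Gamma_0,h_0)$ if the latter is the quotient of the former by $\sigma$, where real edges keep their length and slope and a pair of exchanged edges becomes one edge with half the length and twice the slope. **The map $\Theta$.** Fix $(\Gamma,\sigma,h)$, a total order on the set of $\sigma$-orbits of ends other than $x_r$, and a naming $z^+,z^-$ of the two elements of each pair of exchanged ends. For an edge $\gamma$ let $\iota(\gamma)$ be the smallest orbit of ends reached through $\gamma$ (for an end, its own orbit); this orders the $\sigma$-orbits of edges leaving a real vertex, and the edges leaving a non-real vertex. A point of $\mathcal X\times\mathcal A\times\mathcal B$ is a family $(\chi,\alpha,\beta)$ with $\chi_w\in N_{\mathbb C[[t]]^\times}$ for each vertex, $\alpha_\gamma\in\mathbb C[[t]]^\times$ for each bounded edge, $\beta_\gamma\in\mathbb C[[t]]$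 for each edge other than $x_r$, such that * $\chi_{\sigma(w)}=\overline{\chi_w}$, $\alpha_{\sigma(\gamma)}=\overline{\alpha_\gamma}$, $\beta_{\sigma(\gamma)}=\overline{\beta_\gamma}$ (so that real vertices and edges carry real series); * $\beta_\gamma-\beta_{\gamma'}\in\mathbb C[[t]]^\times$ for distinct edges $\gamma,\gamma'$ with the same tail; * (normalization) at each vertex $w$: if $w$ is real and the smallest orbit of edges leaving $w$ is an exchanged pair $\gamma^\pm$, or else if $w$ is real and the biggest one is such a pair, then $\beta_{\gamma^\pm}=\pm i$, where $\gamma^+$ is the edge leading to the end $z^+$ of $\iota(\gamma^\pm)$; in all other cases $\beta=0$ on the smallest and $\beta=1$ on the biggest edge leaving $w$. Let $y_w$ be the coordinates on $\mathbb P^1$ related by $y_{\mathfrak t(\gamma)}=\beta_\gamma+t^{|\gamma|}\alpha_\gamma\,y_{\mathfrak h(\gamma)}$ for bounded $\gamma$, and let $q_j$ be the marked point with $y_{v_j}(q_j)=\beta_j$ for an end $j\ne x_r$, while $x_r$ has coordinate $y_w=\infty$ for all $w$. Put $$\phi_\gamma=\prod_{i\in I^\infty_{\mathfrak t(\gamma)}\setminus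 I^\infty_{\mathfrak h(\gamma)}}\big(y_{\mathfrak t(\gamma)}(q_i)-\beta_\gamma\big)^{n_i}\prod_{i\notin I^\infty_{\mathfrak t(\gamma)}}\Big(1-\tfrac{\beta_\gamma}{y_{\mathfrak t(\gamma)}(q_i)}\Big)^{n_i},$$ $$\varphi_j=\prod_{i\in I^\infty_{v_j}}\big(\beta_j-y_{v_j}(q_i)\big)^{\omega(n_j,n_i)}\prod_{i\notin I^\infty_{v_j}}\Big(\tfrac{\beta_j}{y_{v_j}(q_i)}-1\Big)^{\omega(n_j,n_i)},$$ where $i$ runs over all ends, including $x_r$, and $0^0=1$; and, with $m_j=\omega(n_j,\cdot)\in M$, $$\Theta(\chi,\alpha,\beta)=\left(\Big(\phi_\gamma\cdot\frac{\chi_{\mathfrak t(\gamma)}}{\chi_{\mathfrak h(\gamma)}}\cdot\alpha_\gamma^{n_\gamma}\Big)_{\gamma\text{ bounded}},\ \big(\chi_{v_j}(m_j)\,\varphi_j\big)_{j\ne x_r}\right),$$ with values in the conjugation invariant families of elements of $N_{\mathbb C[[t]]^\times}$ and $\mathbb C[[t]]^\times$. **Theorem.** Label the ends of the curves of degree $\Delta(s)$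 by $L_0\sqcup\{x_r\}$, with a given slope for each label. There is a finite set of nonzero integral linear forms on $\mathbb Z^{L_0}$ such that the following holds for every $\mu\in\mathbb Z^{L_0}$ at which none of these forms vanishes (every *generic* $\mu$). Let $(\Gamma_0,h_0)$ be a rational parametrized tropical curve of degree $\Delta(s)$, with ends so labelled, whose ends other than $x_r$ have moments $\mu$. Let $(\Gamma,\sigma,h)$ be a real rational parametrized tropical curve of degree $\Delta$, without flat vertex, obtained from $(\Gamma_0,h_0)$, and make the choices of order and naming above. Let $\zeta=(\zeta_j)_{j\neq x_r}$ be a family of nonzero elements of $\mathbb C((t))$, indexed by the ends of $\Gamma$, with $\zeta_{\sigma(j)}=\overline{\zeta_j}$, purely imaginary for non-real $j$, and such that $\mu_{\pi(j)}=\mathrm{val}\,\zeta_j$ if $j$ is real and $\mu_{\pi(j)}=2\,\mathrm{val}\,\zeta_j$ if not, where $\pi(j)$ is the end of $\Gamma_0$ that is the image of $j$. Put $\zeta^\Gamma_j=t^{-\mathrm{val}\,\zeta_j}\zeta_j$. Let $(\chi_0,\alpha_0,\beta_0)\in\mathcal X\times\mathcal A\times\mathcal B$ be a first order solution, i.e.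 $\Theta(\chi_0,\alpha_0,\beta_0)\equiv(1,\zeta^\Gamma)$ mod $t$. Then: 1. the Jacobian of $\Theta$ at $(\chi_0,\alpha_0,\beta_0)$ is invertible mod $t$: the differential of $\Theta|_{t=0}$ at $(\chi_0,\alpha_0,\beta_0)|_{t=0}$ is an $\mathbb R$-linear bijection from the tangent space of $(\mathcal X\times\mathcal A\times\mathcal B)|_{t=0}$ onto the space of conjugation invariant families of elements of $N_{\mathbb C}$ (one for each bounded edge) and of $\mathbb C$ (one for each end $j\ne x_r$); 2. there is a unique $(\chi,\alpha,\beta)\in\mathcal X\times\mathcal A\times\mathcal B$ that is congruent to $(\chi_0,\alpha_0,\beta_0)$ mod $t$ and satisfies $\Theta(\chi,\alpha,\beta)=(1,\zeta^\Gamma)$. -/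

import Mathlib

open scoped Classical BigOperators PowerSeries

noncomputable section

/-- The rank two lattice `N` of co-characters, in a basis. -/
abbrev LatN : Type := Fin 2 → ℤ

/-- The generator `ω` of `Λ² M`, in a basis of `N` with `ω(e₁, e₂) = 1`. -/
def omega (u v : LatN) : ℤ := u 0 * v 1 - u 1 * v 0

/-- A lattice vector is primitive if its coordinates are coprime. -/
def IsPrimitive (n : LatN) : Prop := IsCoprime (n 0) (n 1)

/-- The degree `Δ(s)`: `2 s` copies of `n₁` are replaced with `s` copies of `2 n₁`. -/
def doubledDegree (Δ : Multiset LatN) (n₁ : LatN) (s : ℕ) : Multiset LatN :=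
  Δ - Multiset.replicate (2 * s) n₁ + Multiset.replicate s (2 • n₁)

/-- A rational abstract tropical curve with a distinguished end `x_r`, oriented away from `x_r`,
with integral edge lengths. `V` is the set of (finite) vertices, `B` the set of bounded edges and
`L` the set of ends other than `x_r`; `root` is the vertex adjacent to `x_r`. The edges other than
`x_r` are the elements of `B ⊕ L`. The graph is a finite rooted tree: no edge other than `x_r` has
head `root`, a vertex is the head of at most one bounded edge, and every vertex is joined to `root`
by an oriented path. -/
structure TropTree (V B L : Type) where
  root : V
  tail : B ⊕ L → V
  head : B → V
  head_injective : Function.Injective head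
  head_ne_root : ∀ b, head b ≠ root
  reachable : ∀ v, Relation.ReflTransGen (fun u w => ∃ b, tail (Sum.inl b) = u ∧ head b = w) root v
  /-- Every vertex is at least trivalent: at least two edges leave it, besides the incoming one. -/
  two_le_out : ∀ v, ∃ e e', e ≠ e' ∧ tail e = v ∧ tail e' = v
  len : B → ℕ
  len_pos : ∀ b, 0 < len b

namespace TropTree

variable {V B L : Type}

/-- The partial order `v ≼ w`: the geodesic from `v` to `w` agrees with the orientation. -/
def Le (Γ : TropTree V B L) (v w : V) : Prop :=
  Relation.ReflTransGen (fun u w => ∃ b, Γ.tail (Sum.inl b) = u ∧ Γ.head b = w) v w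

/-- `Γ.Above w l`: the end `l` belongs to `I_w^∞`, the set of ends accessible from `w`. -/
def Above (Γ : TropTree V B L) (w : V) (l : L) : Prop := Γ.Le w (Γ.tail (Sum.inr l))

/-- The end `l` is accessible via the edge `e`. -/
def Through (Γ : TropTree V B L) : B ⊕ L → L → Prop
  | Sum.inl b, l => Γ.Above (Γ.head b) l
  | Sum.inr l', l => l = l'

end TropTree

/-- A rational parametrized tropical curve `h : Γ → N_ℝ`, given by the positions `pos v = h(v)` of
the vertices (lattice points), and the slopes of the edges; `slope e` is the slope along `e`
oriented away from `x_r`, and `rootSlope` is the slope of the end `x_r` oriented toward infinity. -/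
structure TropCurve (V B L : Type) [Fintype B] [Fintype L] extends TropTree V B L where
  pos : V → LatN
  slope : B ⊕ L → LatN
  rootSlope : LatN
  affine : ∀ b, pos (head b) - pos (tail (Sum.inl b)) = len b • slope (Sum.inl b)
  balance_root : rootSlope + ∑ e ∈ Finset.univ.filter (fun e => tail e = root), slope e = 0
  balance_head : ∀ b, - slope (Sum.inl b) +
    ∑ e ∈ Finset.univ.filter (fun e => tail e = head b), slope e = 0

/-- Parameters `(χ, α, β)` with values in `R`: a co-character in `N ⊗ R^× = (R^×)²` for each vertex,
a scalar `α` for each bounded edge, and a scalar `β` for each edge other than `x_r`. -/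
abbrev Params (V B L R : Type) : Type := (V → Fin 2 → R) × (B → R) × (B ⊕ L → R)

/-- The ambient target of `Θ`: an element of `N ⊗ R^×` for each bounded edge, and a scalar for each
end other than `x_r`. -/
abbrev Target (B L R : Type) : Type := (B → Fin 2 → R) × (L → R)

/-- The uniformizer `t` of `ℂ((t))`. -/
def tt : LaurentSeries ℂ := HahnSeries.single 1 1

/-- The inclusion of `ℂ[[t]]` in `ℂ((t))`. -/
def toL (f : ℂ⟦X⟧) : LaurentSeries ℂ := HahnSeries.ofPowerSeries ℤ ℂ f

/-- Coefficientwise complex conjugation on `ℂ[[t]]`. -/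
def conjP (f : ℂ⟦X⟧) : ℂ⟦X⟧ := PowerSeries.map (starRingEnd ℂ) f

/-- Coefficientwise complex conjugation on `ℂ((t))`. -/
def conjL (f : LaurentSeries ℂ) : LaurentSeries ℂ := HahnSeries.map f (starRingEnd ℂ)

/-- Congruence mod `t` in `ℂ((t))`: the difference lies in `t ℂ[[t]]`. -/
def EqModT (f g : LaurentSeries ℂ) : Prop := ∀ n : ℤ, n ≤ 0 → (f - g).coeff n = 0

namespace TropCurve

variable {V B L : Type} [Fintype B] [Fintype L]

/-- The degree: the multiset of slopes of all the ends, oriented toward infinity. -/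
def degree (Γ : TropCurve V B L) : Multiset LatN :=
  Γ.rootSlope ::ₘ (Finset.univ : Finset L).val.map (fun l => Γ.slope (Sum.inr l))

/-- The moment of the end `l`. -/
def moment (Γ : TropCurve V B L) (l : L) : ℤ :=
  omega (Γ.slope (Sum.inr l)) (Γ.pos (Γ.tail (Sum.inr l)))

/-- No vertex is flat, a vertex being flat when the slopes of its adjacent edges are contained in a
line. By the balancing condition it is enough to look at the edges leaving the vertex. -/
def NoFlat (Γ : TropCurve V B L) : Prop :=
  ∀ v, ∃ e e', Γ.tail e = v ∧ Γ.tail e' = v ∧ omega (Γ.slope e) (Γ.slope e') ≠ 0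

/-- The affine changes of coordinate `y_{t(γ)} = β_γ + t^{|γ|} α_γ y_{h(γ)}` compose to
`y_root = center w + scale w * y_w`. This is the linear coefficient: the product of the
`t^{|γ|} α_γ` over the edges `γ` of the path from `root` to `w`. -/
def scale (Γ : TropCurve V B L) (p : Params V B L ℂ⟦X⟧) (w : V) : LaurentSeries ℂ :=
  ∏ b ∈ Finset.univ.filter (fun b => Γ.Le (Γ.head b) w), tt ^ Γ.len b * toL (p.2.1 b)

/-- The constant coefficient in `y_root = center w + scale w * y_w`. -/
def center (Γ : TropCurve V B L) (p : Params V B L ℂ⟦X⟧) (w : V) : LaurentSeries ℂ :=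
  ∑ b ∈ Finset.univ.filter (fun b => Γ.Le (Γ.head b) w),
    Γ.scale p (Γ.tail (Sum.inl b)) * toL (p.2.2 (Sum.inl b))

/-- The coordinate `y_w(q_l)` of the marked point `q_l`, characterized by `y_v(q_l) = β_l` at the
vertex `v` adjacent to `l`. (The marked point of `x_r` has coordinate `∞`.) -/
def ycoord (Γ : TropCurve V B L) (p : Params V B L ℂ⟦X⟧) (w : V) (l : L) : LaurentSeries ℂ :=
  (Γ.center p (Γ.tail (Sum.inr l)) + Γ.scale p (Γ.tail (Sum.inr l)) * toL (p.2.2 (Sum.inr l))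
    - Γ.center p w) / Γ.scale p w

/-- The `i`-th coordinate of the co-character `φ_γ` of a bounded edge
(the factor of `x_r` is `(1 - β_γ / ∞) = 1`). -/
def phiEdge (Γ : TropCurve V B L) (p : Params V B L ℂ⟦X⟧) (b : B) (i : Fin 2) : LaurentSeries ℂ :=
  (∏ l ∈ Finset.univ.filter
      (fun l => Γ.Above (Γ.tail (Sum.inl b)) l ∧ ¬ Γ.Above (Γ.head b) l),
    (Γ.ycoord p (Γ.tail (Sum.inl b)) l - toL (p.2.2 (Sum.inl b))) ^ (Γ.slope (Sum.inr l) i)) *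
  ∏ l ∈ Finset.univ.filter (fun l => ¬ Γ.Above (Γ.tail (Sum.inl b)) l),
    (1 - toL (p.2.2 (Sum.inl b)) / Γ.ycoord p (Γ.tail (Sum.inl b)) l) ^ (Γ.slope (Sum.inr l) i)

/-- The series `φ_j` of the end `j` (the factor of `x_r` is `(β_j / ∞ - 1)^{ω(n_j, n_r)}`). -/
def phiEnd (Γ : TropCurve V B L) (p : Params V B L ℂ⟦X⟧) (j : L) : LaurentSeries ℂ :=
  (∏ l ∈ Finset.univ.filter (fun l => Γ.Above (Γ.tail (Sum.inr j)) l),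
    (toL (p.2.2 (Sum.inr j)) - Γ.ycoord p (Γ.tail (Sum.inr j)) l) ^
      omega (Γ.slope (Sum.inr j)) (Γ.slope (Sum.inr l))) *
  (∏ l ∈ Finset.univ.filter (fun l => ¬ Γ.Above (Γ.tail (Sum.inr j)) l),
    (toL (p.2.2 (Sum.inr j)) / Γ.ycoord p (Γ.tail (Sum.inr j)) l - 1) ^
      omega (Γ.slope (Sum.inr j)) (Γ.slope (Sum.inr l))) *
  (-1) ^ omega (Γ.slope (Sum.inr j)) Γ.rootSlope

/-- The map `Θ`. Its first part is `φ_γ · χ_{t(γ)} / χ_{h(γ)} · α_γ^{n_γ}` for each bounded edge,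
its second part is `χ_{v_j}(m_j) φ_j` for each end `j ≠ x_r`, where `m_j = ω(n_j, ·)`. -/
def theta (Γ : TropCurve V B L) (p : Params V B L ℂ⟦X⟧) : Target B L (LaurentSeries ℂ) :=
  (fun b i => Γ.phiEdge p b i *
      (toL (p.1 (Γ.tail (Sum.inl b)) i) / toL (p.1 (Γ.head b) i)) *
      toL (p.2.1 b) ^ (Γ.slope (Sum.inl b) i),
   fun j =>
      (toL (p.1 (Γ.tail (Sum.inr j)) 0) ^ (-(Γ.slope (Sum.inr j) 1)) *
        toL (p.1 (Γ.tail (Sum.inr j)) 1) ^ (Γ.slope (Sum.inr j) 0)) * Γ.phiEnd p j)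

/-- `Θ` at first order: the constant term of `Θ`, as a function of the constant terms of
`(χ, α, β)`. -/
def thetaZero (Γ : TropCurve V B L) (c : Params V B L ℂ) : Target B L ℂ :=
  let p : Params V B L ℂ⟦X⟧ :=
    (fun v i => PowerSeries.C (c.1 v i), fun b => PowerSeries.C (c.2.1 b),
      fun e => PowerSeries.C (c.2.2 e))
  (fun b i => ((Γ.theta p).1 b i).coeff 0, fun j => ((Γ.theta p).2 j).coeff 0)

end TropCurve

/-- Reduction mod `t` of the parameters. -/
def Params.modT {V B L : Type} (p : Params V B L ℂ⟦X⟧) : Params V B L ℂ :=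
  (fun v i => PowerSeries.constantCoeff (p.1 v i), fun b => PowerSeries.constantCoeff (p.2.1 b),
    fun e => PowerSeries.constantCoeff (p.2.2 e))

/-- A real structure `σ` on a parametrized tropical curve, for which `x_r` is a real end: an
involutive isometry of the graph with `h ∘ σ = h`. -/
structure RealStructure {V B L : Type} [Fintype B] [Fintype L] (Γ : TropCurve V B L) where
  sV : V → V
  sB : B → B
  sL : L → L
  sV_sV : ∀ v, sV (sV v) = v
  sB_sB : ∀ b, sB (sB b) = b
  sL_sL : ∀ l, sL (sL l) = l
  sV_root : sV Γ.root = Γ.root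
  tail_comm : ∀ e, Γ.tail (Sum.map sB sL e) = sV (Γ.tail e)
  head_comm : ∀ b, Γ.head (sB b) = sV (Γ.head b)
  len_comm : ∀ b, Γ.len (sB b) = Γ.len b
  pos_comm : ∀ v, Γ.pos (sV v) = Γ.pos v
  slope_comm : ∀ e, Γ.slope (Sum.map sB sL e) = Γ.slope e

namespace RealStructure

variable {V B L : Type} [Fintype B] [Fintype L] {Γ : TropCurve V B L}

/-- The action of `σ` on the edges other than `x_r`. -/
def sE (σ : RealStructure Γ) : B ⊕ L → B ⊕ L := Sum.map σ.sB σ.sL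

end RealStructure

/-- The real parametrized tropical curve `(Γ, σ)` is obtained from the parametrized tropical curve
`Γ₀` by splitting it in two along a subgraph: `Γ₀` is the quotient of `Γ` by `σ`, where a pair of
exchanged edges of `Γ` becomes an edge with half the length and twice the slope. (The splitting
points are vertices of `Γ₀`: a splitting at an interior point of an edge creates a flat vertex.) -/
structure Splitting {V B L V₀ B₀ L₀ : Type} [Fintype B] [Fintype L] [Fintype B₀] [Fintype L₀]
    (Γ : TropCurve V B L) (σ : RealStructure Γ) (Γ₀ : TropCurve V₀ B₀ L₀) where
  pV : V → V₀
  pB : B → B₀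
  pL : L → L₀
  pV_surjective : Function.Surjective pV
  pB_surjective : Function.Surjective pB
  pL_surjective : Function.Surjective pL
  pV_eq_iff : ∀ v w, pV v = pV w ↔ w = v ∨ w = σ.sV v
  pB_eq_iff : ∀ b c, pB b = pB c ↔ c = b ∨ c = σ.sB b
  pL_eq_iff : ∀ l k, pL l = pL k ↔ k = l ∨ k = σ.sL l
  root_comm : pV Γ.root = Γ₀.root
  tail_comm : ∀ e, Γ₀.tail (Sum.map pB pL e) = pV (Γ.tail e)
  head_comm : ∀ b, Γ₀.head (pB b) = pV (Γ.head b)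
  pos_comm : ∀ v, Γ₀.pos (pV v) = Γ.pos v
  len_real : ∀ b, σ.sB b = b → Γ₀.len (pB b) = Γ.len b
  len_complex : ∀ b, σ.sB b ≠ b → 2 * Γ₀.len (pB b) = Γ.len b
  slope_real : ∀ e, σ.sE e = e → Γ₀.slope (Sum.map pB pL e) = Γ.slope e
  slope_complex : ∀ e, σ.sE e ≠ e → Γ₀.slope (Sum.map pB pL e) = 2 • Γ.slope e
  rootSlope_eq : Γ₀.rootSlope = Γ.rootSlope

/-- The auxiliary choices: a total order on the set `(I ∖ {x_r})/σ`, given by an injective ranking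
of the orbits, and the naming `z^+`, `z^-` of the elements of each pair of exchanged ends. -/
structure Marking {V B L : Type} [Fintype B] [Fintype L] {Γ : TropCurve V B L}
    (σ : RealStructure Γ) where
  rank : L → ℕ
  rank_eq_iff : ∀ l k, rank l = rank k ↔ k = l ∨ k = σ.sL l
  plus : L → Prop
  plus_iff : ∀ l, σ.sL l ≠ l → (plus (σ.sL l) ↔ ¬ plus l)

namespace Marking

variable {V B L : Type} [Fintype B] [Fintype L] {Γ : TropCurve V B L} {σ : RealStructure Γ}

/-- The rank of `ι(e)`, the smallest marking accessible via `e`. -/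
def iota (m : Marking σ) (e : B ⊕ L) : ℕ := sInf {k | ∃ l, Γ.Through e l ∧ m.rank l = k}

/-- The marking `ι(e)` is of the form `z_j^+` (for an edge that is exchanged with another one). -/
def LeadsPlus (m : Marking σ) (e : B ⊕ L) : Prop :=
  ∃ l, Γ.Through e l ∧ m.rank l = m.iota e ∧ m.plus l

/-- `e` is a smallest edge among those leaving its tail. -/
def IsMin (m : Marking σ) (e : B ⊕ L) : Prop := ∀ e', Γ.tail e' = Γ.tail e → m.iota e ≤ m.iota e'

/-- `e` is a biggest edge among those leaving its tail. -/
def IsMax (m : Marking σ) (e : B ⊕ L) : Prop := ∀ e', Γ.tail e' = Γ.tail e → m.iota e' ≤ m.iota e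

/-- The coordinate at the tail of `e`, a real vertex, is normalized by the pair of exchanged edges
`e, σ(e)`: either this is the smallest pair, or the smallest edge is real and this is the biggest
pair. -/
def NormCC (m : Marking σ) (e : B ⊕ L) : Prop :=
  σ.sV (Γ.tail e) = Γ.tail e ∧ σ.sE e ≠ e ∧
    (m.IsMin e ∨ (m.IsMax e ∧ ∀ e', Γ.tail e' = Γ.tail e → m.IsMin e' → σ.sE e' = e'))

/-- The coordinate at `w` takes the values `0` and `1` on the smallest and biggest edges: either `w`
is not real, or the smallest and the biggest edge leaving `w` are real edges. -/
def Norm01 (m : Marking σ) (w : V) : Prop :=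
  σ.sV w = w → ∀ e, Γ.tail e = w → m.IsMin e ∨ m.IsMax e → σ.sE e = e

/-- `m.Normalized e c`: the normalization of the coordinate at the tail of `e` imposes
`β_e = c`. -/
inductive Normalized (m : Marking σ) : B ⊕ L → ℂ → Prop
  | plus (e : B ⊕ L) : m.NormCC e → m.LeadsPlus e → Normalized m e Complex.I
  | minus (e : B ⊕ L) : m.NormCC e → ¬ m.LeadsPlus e → Normalized m e (-Complex.I)
  | zero (e : B ⊕ L) : m.Norm01 (Γ.tail e) → m.IsMin e → Normalized m e 0
  | one (e : B ⊕ L) : m.Norm01 (Γ.tail e) → m.IsMax e → Normalized m e 1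

/-- The space `𝒳 × 𝒜 × ℬ`. A factor over `ℝ[[t]]` for each real vertex or edge and a factor over
`ℂ[[t]]` for each pair of exchanged ones is the same as a conjugation invariant family. -/
structure InSpace (m : Marking σ) (p : Params V B L ℂ⟦X⟧) : Prop where
  chi_unit : ∀ v i, IsUnit (p.1 v i)
  chi_real : ∀ v i, p.1 (σ.sV v) i = conjP (p.1 v i)
  alpha_unit : ∀ b, IsUnit (p.2.1 b)
  alpha_real : ∀ b, p.2.1 (σ.sB b) = conjP (p.2.1 b)
  beta_sub_unit : ∀ e e', e ≠ e' → Γ.tail e = Γ.tail e' → IsUnit (p.2.2 e - p.2.2 e')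
  beta_real : ∀ e, p.2.2 (σ.sE e) = conjP (p.2.2 e)
  beta_norm : ∀ e c, m.Normalized e c → p.2.2 e = PowerSeries.C c

/-- The (real) tangent space of `𝒳 × 𝒜 × ℬ` mod `t`. -/
def tangent (m : Marking σ) : Submodule ℝ (Params V B L ℂ) where
  carrier := {d | (∀ v i, d.1 (σ.sV v) i = starRingEnd ℂ (d.1 v i)) ∧
    (∀ b, d.2.1 (σ.sB b) = starRingEnd ℂ (d.2.1 b)) ∧
    (∀ e, d.2.2 (σ.sE e) = starRingEnd ℂ (d.2.2 e)) ∧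
    ∀ e c, m.Normalized e c → d.2.2 e = 0}
  add_mem' := by
    rintro a b ⟨h1, h2, h3, h4⟩ ⟨k1, k2, k3, k4⟩
    refine ⟨fun v i => ?_, fun x => ?_, fun e => ?_, fun e c h => ?_⟩
    · simp [h1, k1]
    · simp [h2, k2]
    · simp [h3, k3]
    · simp [h4 e c h, k4 e c h]
  zero_mem' := by simp
  smul_mem' := by
    rintro r a ⟨h1, h2, h3, h4⟩
    refine ⟨fun v i => ?_, fun x => ?_, fun e => ?_, fun e c h => ?_⟩
    · simp [h1]
    · simp [h2]
    · simp [h3]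
    · simp [h4 e c h]

end Marking

/-- The (real) tangent space of the target of `Θ` mod `t`: the conjugation invariant families. -/
def RealStructure.targetTangent {V B L : Type} [Fintype B] [Fintype L] {Γ : TropCurve V B L}
    (σ : RealStructure Γ) : Submodule ℝ (Target B L ℂ) where
  carrier := {d | (∀ b i, d.1 (σ.sB b) i = starRingEnd ℂ (d.1 b i)) ∧
    ∀ l, d.2 (σ.sL l) = starRingEnd ℂ (d.2 l)}
  add_mem' := by
    rintro a b ⟨h1, h2⟩ ⟨k1, k2⟩
    refine ⟨fun x i => ?_, fun l => ?_⟩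
    · simp [h1, k1]
    · simp [h2, k2]
  zero_mem' := by simp
  smul_mem' := by
    rintro r a ⟨h1, h2⟩
    refine ⟨fun x i => ?_, fun l => ?_⟩
    · simp [h1]
    · simp [h2]

/-- A family of complex moments: real at the real ends, purely imaginary at the exchanged ends
(with conjugated values at conjugated ends). -/
structure IsMomentFamily {V B L : Type} [Fintype B] [Fintype L] {Γ : TropCurve V B L}
    (σ : RealStructure Γ) (ζ : L → LaurentSeries ℂ) : Prop where
  ne_zero : ∀ l, ζ l ≠ 0
  conj : ∀ l, ζ (σ.sL l) = conjL (ζ l)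
  imaginary : ∀ l, σ.sL l ≠ l → conjL (ζ l) = - ζ l

/-- The normalized moments `ζ^Γ = ζ t^{- val ζ}`. -/
def normMoment (ζ : LaurentSeries ℂ) : LaurentSeries ℂ := HahnSeries.single (-ζ.order) 1 * ζ

/-- `(χ, α, β)` is a true solution of `Θ = (1, ζ^Γ)`. -/
def IsSolution {V B L : Type} [Fintype B] [Fintype L] (Γ : TropCurve V B L)
    (ζ : L → LaurentSeries ℂ) (p : Params V B L ℂ⟦X⟧) : Prop :=
  (∀ b i, (Γ.theta p).1 b i = 1) ∧ ∀ l, (Γ.theta p).2 l = normMoment (ζ l)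

/-- `(χ, α, β)` is a first order solution: `Θ = (1, ζ^Γ)` mod `t`. -/
def IsFirstOrderSolution {V B L : Type} [Fintype B] [Fintype L] (Γ : TropCurve V B L)
    (ζ : L → LaurentSeries ℂ) (p : Params V B L ℂ⟦X⟧) : Prop :=
  (∀ b i, EqModT ((Γ.theta p).1 b i) 1) ∧ ∀ l, EqModT ((Γ.theta p).2 l) (normMoment (ζ l))

/-- The Jacobian of `Θ` at `(χ, α, β)` is invertible mod `t`: the constant term of `Θ` is a
differentiable function of the constant terms of `(χ, α, β)`, and its differential is bijective from
the tangent space of the source to the one of the target. -/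
def JacobianInvertible {V B L : Type} [Fintype V] [Fintype B] [Fintype L] {Γ : TropCurve V B L}
    {σ : RealStructure Γ} (m : Marking σ) (p : Params V B L ℂ⟦X⟧) : Prop :=
  ∃ D : Params V B L ℂ →L[ℝ] Target B L ℂ,
    HasFDerivAt Γ.thetaZero D (Params.modT p) ∧
    Set.BijOn D (m.tangent : Set (Params V B L ℂ)) (σ.targetTangent : Set (Target B L ℂ))

end

noncomputable section

namespace TropTree

variable {V B L : Type} (Γ : TropTree V B L)

lemma le_refl (v : V) : Γ.Le v v := Relation.ReflTransGen.refl

variable {Γ}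

lemma Le.trans {u v w : V} (h : Γ.Le u v) (h' : Γ.Le v w) : Γ.Le u w :=
  Relation.ReflTransGen.trans h h'

lemma tail_le_head (b : B) : Γ.Le (Γ.tail (Sum.inl b)) (Γ.head b) :=
  Relation.ReflTransGen.single ⟨b, rfl, rfl⟩

lemma le_head_iff {w : V} {b : B} :
    Γ.Le w (Γ.head b) ↔ w = Γ.head b ∨ Γ.Le w (Γ.tail (Sum.inl b)) := by
  constructor
  · intro h
    rcases Relation.ReflTransGen.cases_tail h with h | ⟨u, h1, b', h2, h3⟩
    · exact Or.inl h.symm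
    · obtain rfl := Γ.head_injective h3
      exact Or.inr (h2 ▸ h1)
  · rintro (rfl | h)
    · exact Γ.le_refl _
    · exact h.trans (tail_le_head b)

lemma Le.eq_or_exists {u w : V} (h : Γ.Le u w) :
    u = w ∨ ∃ b, Γ.tail (Sum.inl b) = u ∧ Γ.Le (Γ.head b) w := by
  rcases Relation.ReflTransGen.cases_head h with h | ⟨v, ⟨b, h1, rfl⟩, h3⟩
  · exact Or.inl h
  · exact Or.inr ⟨b, h1, h3⟩

/-- Induction from the root along the oriented edges. -/
lemma root_induction {P : V → Prop} (h0 : P Γ.root)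
    (h1 : ∀ b, P (Γ.tail (Sum.inl b)) → P (Γ.head b)) (v : V) : P v := by
  have := Γ.reachable v
  induction this with
  | refl => exact h0
  | tail _ h ih => obtain ⟨b, rfl, rfl⟩ := h; exact h1 b ih

lemma eq_root_or_head (v : V) : v = Γ.root ∨ ∃ b, Γ.head b = v :=
  root_induction (P := fun v => v = Γ.root ∨ ∃ b, Γ.head b = v) (Or.inl rfl)
    (fun b _ => Or.inr ⟨b, rfl⟩) v

lemma le_root_iff {w : V} : Γ.Le w Γ.root ↔ w = Γ.root := by
  constructor
  · intro h
    rcases Relation.ReflTransGen.cases_tail h with h | ⟨u, h1, b', h2, h3⟩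
    · exact h.symm
    · exact absurd h3 (Γ.head_ne_root b')
  · rintro rfl
    exact Γ.le_refl _

lemma not_head_le_tail (b : B) : ¬ Γ.Le (Γ.head b) (Γ.tail (Sum.inl b)) := by
  have key : ∀ v, ∀ b, Γ.tail (Sum.inl b) = v → ¬ Γ.Le (Γ.head b) v := by
    intro v
    induction v using Γ.root_induction with
    | h0 => exact fun b _ h => Γ.head_ne_root b (le_root_iff.1 h)
    | h1 b ih =>
      intro b' hb' h
      rcases le_head_iff.1 h with h | h
      · obtain rfl := Γ.head_injective h
        exact ih b' rfl (hb' ▸ Γ.le_refl _)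
      · have h' := tail_le_head (Γ := Γ) b'
        rw [hb'] at h'
        exact ih b rfl (h'.trans h)
  exact key _ b rfl

lemma Le.antisymm {u w : V} (h : Γ.Le u w) (h' : Γ.Le w u) : u = w := by
  rcases h.eq_or_exists with h | ⟨b, rfl, h2⟩
  · exact h
  · exact absurd (h2.trans h') (not_head_le_tail b)

lemma Le.total {u v w : V} (h : Γ.Le u w) (h' : Γ.Le v w) : Γ.Le u v ∨ Γ.Le v u := by
  induction w using Γ.root_induction with
  | h0 =>
    rw [le_root_iff] at h h'
    exact Or.inl (by rw [h, h']; exact Γ.le_refl _)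
  | h1 b ih =>
    rcases le_head_iff.1 h with rfl | h1
    · exact Or.inr h'
    · rcases le_head_iff.1 h' with rfl | h2
      · exact Or.inl h
      · exact ih h1 h2

lemma eq_of_head_le {b b' : B} {w : V} (ht : Γ.tail (Sum.inl b) = Γ.tail (Sum.inl b'))
    (h : Γ.Le (Γ.head b) w) (h' : Γ.Le (Γ.head b') w) : b = b' := by
  rcases h.total h' with h | h
  · rcases le_head_iff.1 h with h | h
    · exact Γ.head_injective h
    · exact absurd (ht ▸ h) (not_head_le_tail b)
  · rcases le_head_iff.1 h with h | h
    · exact (Γ.head_injective h).symm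
    · exact absurd (ht ▸ h) (not_head_le_tail b')

lemma Through.above {e : B ⊕ L} {l : L} (h : Γ.Through e l) : Γ.Above (Γ.tail e) l := by
  rcases e with b | j
  · exact (tail_le_head b).trans h
  · obtain rfl : l = j := h
    exact Γ.le_refl _

lemma Through.eq {e e' : B ⊕ L} {l : L} (h : Γ.Through e l) (h' : Γ.Through e' l)
    (ht : Γ.tail e = Γ.tail e') : e = e' := by
  rcases e with b | j <;> rcases e' with b' | j'
  · rw [eq_of_head_le ht h h']
  · obtain rfl : l = j' := h'
    exact absurd (by rw [ht]; exact h) (not_head_le_tail b)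
  · obtain rfl : l = j := h
    exact absurd (by rw [← ht]; exact h') (not_head_le_tail b')
  · obtain rfl : l = j := h
    obtain rfl : l = j' := h'
    rfl

lemma Above.exists_through {w : V} {l : L} (h : Γ.Above w l) :
    ∃ e, Γ.tail e = w ∧ Γ.Through e l := by
  rcases Le.eq_or_exists h with h | ⟨b, h1, h2⟩
  · exact ⟨Sum.inr l, h.symm, rfl⟩
  · exact ⟨Sum.inl b, h1, h2⟩

/-- The edge leaving `w` which leads to the end `l` above `w`. -/
def dir (Γ : TropTree V B L) (w : V) (l : L) : B ⊕ L :=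
  if h : ∃ e, Γ.tail e = w ∧ Γ.Through e l then h.choose else Sum.inr l

lemma Through.dir_eq {e : B ⊕ L} {l : L} (h : Γ.Through e l) : Γ.dir (Γ.tail e) l = e := by
  have hex : ∃ e', Γ.tail e' = Γ.tail e ∧ Γ.Through e' l := ⟨e, rfl, h⟩
  rw [dir, dif_pos hex]
  exact Through.eq hex.choose_spec.2 h hex.choose_spec.1

lemma Above.tail_dir {w : V} {l : L} (h : Γ.Above w l) : Γ.tail (Γ.dir w l) = w := by
  obtain ⟨e, rfl, he⟩ := h.exists_through
  rw [he.dir_eq]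

lemma Above.through_dir {w : V} {l : L} (h : Γ.Above w l) : Γ.Through (Γ.dir w l) l := by
  obtain ⟨e, rfl, he⟩ := h.exists_through
  rwa [he.dir_eq]

lemma Above.through_iff {e : B ⊕ L} {l : L} (h : Γ.Above (Γ.tail e) l) :
    Γ.Through e l ↔ Γ.dir (Γ.tail e) l = e :=
  ⟨fun h => h.dir_eq, fun h' => h' ▸ h.through_dir⟩

section Ancestors

variable [Fintype B] {M : Type*}

lemma filter_le_head (b₀ : B) :
    Finset.univ.filter (fun b => Γ.Le (Γ.head b) (Γ.head b₀)) =
      insert b₀ (Finset.univ.filter (fun b => Γ.Le (Γ.head b) (Γ.tail (Sum.inl b₀)))) := by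
  ext b
  simp [le_head_iff, Γ.head_injective.eq_iff]

@[to_additive]
lemma prod_ancestors_head [CommMonoid M] (f : B → M) (b₀ : B) :
    ∏ b ∈ Finset.univ.filter (fun b => Γ.Le (Γ.head b) (Γ.head b₀)), f b =
      f b₀ * ∏ b ∈ Finset.univ.filter (fun b => Γ.Le (Γ.head b) (Γ.tail (Sum.inl b₀))), f b := by
  rw [filter_le_head, Finset.prod_insert (by simpa using not_head_le_tail b₀)]

@[to_additive]
lemma prod_ancestors_root [CommMonoid M] (f : B → M) :
    ∏ b ∈ Finset.univ.filter (fun b => Γ.Le (Γ.head b) Γ.root), f b = 1 := by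
  refine Finset.prod_eq_one fun b hb => ?_
  simp only [Finset.mem_filter, le_root_iff] at hb
  exact absurd hb.2 (Γ.head_ne_root b)

end Ancestors

lemma two_le_card_out [Fintype B] [Fintype L] (Γ : TropTree V B L) (v : V) :
    2 ≤ (Finset.univ.filter (fun e => Γ.tail e = v)).card := by
  obtain ⟨e, e', h, h1, h2⟩ := Γ.two_le_out v
  exact Finset.one_lt_card.2 ⟨e, by simpa using h1, e', by simpa using h2, h⟩

section Card

variable [Fintype V] [Fintype B]

lemma card_vertices (Γ : TropTree V B L) : Fintype.card V = Fintype.card B + 1 := by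
  rw [← Fintype.card_option]
  symm
  refine Fintype.card_of_bijective (f := fun o : Option B => o.elim Γ.root Γ.head) ⟨?_, ?_⟩
  · rintro (_ | b) (_ | b') h
    · rfl
    · exact absurd h.symm (Γ.head_ne_root b')
    · exact absurd h (Γ.head_ne_root b)
    · exact congrArg _ (Γ.head_injective h)
  · intro v
    rcases Γ.eq_root_or_head v with rfl | ⟨b, rfl⟩
    · exact ⟨none, rfl⟩
    · exact ⟨some b, rfl⟩

lemma sum_card_out [Fintype L] (Γ : TropTree V B L) :
    ∑ v, (Finset.univ.filter (fun e => Γ.tail e = v)).card = Fintype.card B + Fintype.card L := by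
  rw [← Fintype.card_sum, ← Finset.card_univ]
  exact (Finset.card_eq_sum_card_fiberwise (fun _ _ => Finset.mem_coe.2 (Finset.mem_univ _))).symm

lemma card_bounded_add_two_le [Fintype L] (Γ : TropTree V B L) :
    Fintype.card B + 2 ≤ Fintype.card L := by
  have h1 := Γ.sum_card_out
  have h2 := Finset.sum_le_sum (s := Finset.univ) fun v _ => Γ.two_le_card_out v
  simp only [Finset.sum_const, Finset.card_univ, smul_eq_mul, Γ.card_vertices] at h2
  omega

lemma card_out_eq_two [Fintype L] (Γ : TropTree V B L)
    (h : Fintype.card L ≤ Fintype.card B + 2) (v : V) :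
    (Finset.univ.filter (fun e => Γ.tail e = v)).card = 2 := by
  have h1 := Γ.sum_card_out
  have h2 : ∑ v : V, 2 = ∑ v, (Finset.univ.filter (fun e => Γ.tail e = v)).card := by
    refine _root_.le_antisymm (Finset.sum_le_sum fun v _ => Γ.two_le_card_out v) ?_
    simp only [Finset.sum_const, Finset.card_univ, smul_eq_mul, Γ.card_vertices]
    omega
  exact ((Finset.sum_eq_sum_iff_of_le fun v _ => Γ.two_le_card_out v).1 h2 v
    (Finset.mem_univ v)).symm

end Card

/-- Induction towards the root: a property of bounded edges holds if it propagates from the edges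
leaving the head of an edge to that edge. -/
lemma leaf_induction [Finite V] {P : B ⊕ L → Prop} (h0 : ∀ l, P (Sum.inr l))
    (h1 : ∀ b, (∀ e, Γ.tail e = Γ.head b → P e) → P (Sum.inl b)) (e : B ⊕ L) : P e := by
  have hwf : WellFounded (fun u w : V => Γ.Le w u ∧ w ≠ u) := by
    have : IsTrans V (fun u w : V => Γ.Le w u ∧ w ≠ u) :=
      ⟨fun a b c h h' => ⟨h'.1.trans h.1, fun hc => by
        subst hc; exact h.2 (h.1.antisymm h'.1)⟩⟩
    have : Std.Irrefl (fun u w : V => Γ.Le w u ∧ w ≠ u) := ⟨fun a h => h.2 rfl⟩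
    exact Finite.wellFounded_of_trans_of_irrefl _
  have key : ∀ v, ∀ e, Γ.tail e = v → P e := by
    intro v
    induction v using hwf.induction with
    | _ v ih =>
      rintro (b | l) he
      · refine h1 b fun e' he' => ih (Γ.head b) ⟨he ▸ tail_le_head b, ?_⟩ e' he'
        rintro rfl
        exact not_head_le_tail b (by rw [he]; exact Γ.le_refl _)
      · exact h0 l
  exact key _ e rfl

end TropTree

namespace TropCurve

variable {V B L : Type} [Fintype B] [Fintype L] (Γ : TropCurve V B L)

lemma sum_above {M : Type*} [AddCommMonoid M] (w : V) (f : L → M) :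
    ∑ l ∈ Finset.univ.filter (fun l => Γ.Above w l), f l =
      ∑ e ∈ Finset.univ.filter (fun e => Γ.tail e = w),
        ∑ l ∈ Finset.univ.filter (fun l => Γ.Through e l), f l := by
  rw [← Finset.sum_fiberwise_of_maps_to
    (t := Finset.univ.filter (fun e => Γ.tail e = w)) (g := Γ.dir w)]
  · refine Finset.sum_congr rfl fun e he => ?_
    obtain rfl : Γ.tail e = w := by simpa using he
    refine Finset.sum_congr ?_ fun _ _ => rfl
    ext l
    simp only [Finset.mem_filter, Finset.mem_univ, true_and]
    exact ⟨fun h => h.1.through_iff.2 h.2, fun h => ⟨h.above, h.dir_eq⟩⟩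
  · intro l hl
    simp only [Finset.mem_filter, Finset.mem_univ, true_and] at hl ⊢
    exact hl.tail_dir

/-- The slope of an edge is the sum of the slopes of the ends accessible via this edge. -/
lemma slope_eq_sum [Finite V] (e : B ⊕ L) :
    Γ.slope e = ∑ l ∈ Finset.univ.filter (fun l => Γ.Through e l), Γ.slope (Sum.inr l) := by
  induction e using Γ.leaf_induction with
  | h0 l =>
    have : Finset.univ.filter (fun l' => Γ.Through (Sum.inr l) l') = {l} := by
      ext l'
      rw [Finset.mem_filter, Finset.mem_singleton]
      exact and_iff_right (Finset.mem_univ _)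
    rw [this, Finset.sum_singleton]
  | h1 b ih =>
    have h := Γ.balance_head b
    rw [neg_add_eq_zero] at h
    rw [h]
    refine Eq.trans ?_ (Γ.sum_above (Γ.head b) _).symm
    exact Finset.sum_congr rfl fun e he => ih e (by simpa using he)

lemma pos_eq (w : V) :
    Γ.pos w = Γ.pos Γ.root + ∑ b ∈ Finset.univ.filter (fun b => Γ.Le (Γ.head b) w),
      Γ.len b • Γ.slope (Sum.inl b) := by
  induction w using Γ.root_induction with
  | h0 => rw [Γ.sum_ancestors_root, add_zero]
  | h1 b ih =>
    rw [Γ.sum_ancestors_head, ← Γ.affine, add_left_comm, ← ih, sub_add_cancel]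

end TropCurve

lemma toL_injective : Function.Injective toL := HahnSeries.ofPowerSeries_injective

lemma toL_ne_zero {f : ℂ⟦X⟧} (h : PowerSeries.constantCoeff f ≠ 0) : toL f ≠ 0 := by
  intro h0
  have : f = 0 := toL_injective (h0.trans (map_zero (HahnSeries.ofPowerSeries ℤ ℂ)).symm)
  exact h (by rw [this, map_zero])

lemma toL_inv {f : ℂ⟦X⟧} (h : PowerSeries.constantCoeff f ≠ 0) : (toL f)⁻¹ = toL f⁻¹ := by
  refine inv_eq_of_mul_eq_one_right ?_
  rw [toL, toL, ← map_mul, PowerSeries.mul_inv_cancel f h, map_one]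

lemma tt_pow_eq (k : ℕ) : tt ^ k = toL (PowerSeries.X ^ k) := by
  rw [toL, map_pow, HahnSeries.ofPowerSeries_X, tt]

/-- `F` and `F'` are power series which are congruent modulo `t ^ n`; the constant term of `F` is
`c` and the coefficient of `t ^ n` in `F' - F` is `d`. -/
def Jet (n : ℕ) (F F' : LaurentSeries ℂ) (c d : ℂ) : Prop :=
  ∃ f g : ℂ⟦X⟧, F = toL f ∧ F' = toL (f + PowerSeries.X ^ n * g) ∧
    PowerSeries.constantCoeff f = c ∧ PowerSeries.constantCoeff g = d

namespace Jet

open PowerSeries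

variable {n : ℕ} {F F' G G' : LaurentSeries ℂ} {c d c' d' : ℂ}

lemma const_self (n : ℕ) (F : ℂ⟦X⟧) : Jet n (toL F) (toL F) (constantCoeff F) 0 :=
  ⟨F, 0, rfl, by rw [mul_zero, add_zero], rfl, map_zero _⟩

lemma one (n : ℕ) : Jet n 1 1 1 0 := by
  have := const_self n 1
  rwa [toL, map_one, map_one] at this

lemma add (h : Jet n F F' c d) (h' : Jet n G G' c' d') :
    Jet n (F + G) (F' + G') (c + c') (d + d') := by
  obtain ⟨f, f', rfl, rfl, rfl, rfl⟩ := h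
  obtain ⟨g, g', rfl, rfl, rfl, rfl⟩ := h'
  refine ⟨f + g, f' + g', (map_add _ _ _).symm, ?_, map_add _ _ _, map_add _ _ _⟩
  rw [toL, toL, toL, ← map_add]
  congr 1
  ring

lemma neg (h : Jet n F F' c d) : Jet n (-F) (-F') (-c) (-d) := by
  obtain ⟨f, f', rfl, rfl, rfl, rfl⟩ := h
  refine ⟨-f, -f', (map_neg _ _).symm, ?_, map_neg _ _, map_neg _ _⟩
  rw [toL, toL, ← map_neg]
  congr 1
  ring

lemma sub (h : Jet n F F' c d) (h' : Jet n G G' c' d') :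
    Jet n (F - G) (F' - G') (c - c') (d - d') := by
  simpa only [sub_eq_add_neg] using h.add h'.neg

lemma mul (hn : 0 < n) (h : Jet n F F' c d) (h' : Jet n G G' c' d') :
    Jet n (F * G) (F' * G') (c * c') (c * d' + d * c') := by
  obtain ⟨f, f', rfl, rfl, rfl, rfl⟩ := h
  obtain ⟨g, g', rfl, rfl, rfl, rfl⟩ := h'
  refine ⟨f * g, f * g' + f' * g + X ^ n * (f' * g'), (map_mul _ _ _).symm, ?_, map_mul _ _ _, ?_⟩
  · rw [toL, toL, toL, ← map_mul]
    congr 1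
    ring
  · simp [hn.ne']

lemma inv (hn : 0 < n) (h : Jet n F F' c d) (hc : c ≠ 0) :
    Jet n F⁻¹ F'⁻¹ c⁻¹ (-(c⁻¹ * c⁻¹ * d)) := by
  obtain ⟨f, g, rfl, rfl, rfl, rfl⟩ := h
  have h0 : constantCoeff (f + X ^ n * g) = constantCoeff f := by simp [hn.ne']
  have hc' : constantCoeff (f + X ^ n * g) ≠ 0 := by rwa [h0]
  refine ⟨f⁻¹, -(f⁻¹ * (f + X ^ n * g)⁻¹ * g), toL_inv hc, ?_, by simp, by simp [hn.ne']⟩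
  rw [toL_inv hc']
  congr 1
  have h1 := PowerSeries.mul_inv_cancel f hc
  have h2 := PowerSeries.mul_inv_cancel _ hc'
  linear_combination (f + X ^ n * g)⁻¹ * (-h1) + f⁻¹ * h2

lemma ne_zero (hn : 0 < n) (h : Jet n F F' c d) (hc : c ≠ 0) : F ≠ 0 ∧ F' ≠ 0 := by
  obtain ⟨f, g, rfl, rfl, rfl, rfl⟩ := h
  exact ⟨toL_ne_zero hc, toL_ne_zero (by simpa [hn.ne'] using hc)⟩

lemma tt_pow_mul {k : ℕ} (hk : 0 < k) (h : Jet n F F' c d) :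
    Jet n (tt ^ k * F) (tt ^ k * F') 0 0 := by
  obtain ⟨f, g, rfl, rfl, rfl, rfl⟩ := h
  refine ⟨X ^ k * f, X ^ k * g, ?_, ?_, by simp [hk.ne'], by simp [hk.ne']⟩
  · rw [tt_pow_eq, toL, toL, toL, map_mul]
  · rw [tt_pow_eq, toL, toL, toL, ← map_mul]
    congr 1
    ring

end Jet

/-- A jet with nonzero constant term `c`, given with its logarithmic derivative `l`. -/
def LogJet (n : ℕ) (F F' : LaurentSeries ℂ) (c l : ℂ) : Prop := c ≠ 0 ∧ Jet n F F' c (c * l)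

namespace LogJet

variable {n : ℕ} {F F' G G' : LaurentSeries ℂ} {c l c' l' : ℂ}

lemma of_jet {d : ℂ} (h : Jet n F F' c d) (hc : c ≠ 0) : LogJet n F F' c (d / c) :=
  ⟨hc, by rwa [mul_div_cancel₀ _ hc]⟩

lemma one (n : ℕ) : LogJet n 1 1 1 0 := ⟨one_ne_zero, by simpa using Jet.one n⟩

lemma mul (hn : 0 < n) (h : LogJet n F F' c l) (h' : LogJet n G G' c' l') :
    LogJet n (F * G) (F' * G') (c * c') (l + l') := by
  refine ⟨mul_ne_zero h.1 h'.1, ?_⟩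
  convert h.2.mul hn h'.2 using 1
  ring

lemma inv (hn : 0 < n) (h : LogJet n F F' c l) : LogJet n F⁻¹ F'⁻¹ c⁻¹ (-l) := by
  have hc := h.1
  refine ⟨inv_ne_zero hc, ?_⟩
  convert h.2.inv hn hc using 1
  field_simp

lemma div (hn : 0 < n) (h : LogJet n F F' c l) (h' : LogJet n G G' c' l') :
    LogJet n (F / G) (F' / G') (c / c') (l - l') := by
  simpa only [div_eq_mul_inv, sub_eq_add_neg] using h.mul hn (h'.inv hn)

lemma pow (hn : 0 < n) (h : LogJet n F F' c l) (k : ℕ) :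
    LogJet n (F ^ k) (F' ^ k) (c ^ k) (k * l) := by
  induction k with
  | zero => simpa using one n
  | succ k ih =>
    convert ih.mul hn h using 1 <;> first | rw [pow_succ] | (push_cast; ring)

lemma zpow (hn : 0 < n) (h : LogJet n F F' c l) (k : ℤ) :
    LogJet n (F ^ k) (F' ^ k) (c ^ k) (k * l) := by
  rcases k with k | k
  · simpa using h.pow hn k
  · simpa only [zpow_negSucc, Int.cast_negSucc, neg_mul] using (h.pow hn (k + 1)).inv hn

lemma prod (hn : 0 < n) {ι : Type*} {f f' : ι → LaurentSeries ℂ} {a b : ι → ℂ} (s : Finset ι)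
    (h : ∀ i ∈ s, LogJet n (f i) (f' i) (a i) (b i)) :
    LogJet n (∏ i ∈ s, f i) (∏ i ∈ s, f' i) (∏ i ∈ s, a i) (∑ i ∈ s, b i) := by
  induction s using Finset.induction_on with
  | empty => simpa using one n
  | insert i s hi ih =>
    rw [Finset.prod_insert hi, Finset.prod_insert hi, Finset.prod_insert hi, Finset.sum_insert hi]
    exact (h i (by simp)).mul hn (ih fun j hj => h j (by simp [hj]))

end LogJet

namespace TropCurve

variable {V B L : Type} [Fintype B] [Fintype L] (Γ : TropCurve V B L)

/-- The open conditions on the constant terms of the points of `𝒳 × 𝒜 × ℬ`. -/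
structure Regular (c : Params V B L ℂ) : Prop where
  chi_ne : ∀ v i, c.1 v i ≠ 0
  alpha_ne : ∀ b, c.2.1 b ≠ 0
  beta_ne : ∀ e e', e ≠ e' → Γ.tail e = Γ.tail e' → c.2.2 e ≠ c.2.2 e'

/-- `Θ` modulo `t`, as a function of the constant terms of the parameters. -/
def lead (c : Params V B L ℂ) : Target B L ℂ :=
  (fun b i =>
    (∏ l ∈ Finset.univ.filter
        (fun l => Γ.Above (Γ.tail (Sum.inl b)) l ∧ ¬ Γ.Above (Γ.head b) l),
      (c.2.2 (Γ.dir (Γ.tail (Sum.inl b)) l) - c.2.2 (Sum.inl b)) ^ (Γ.slope (Sum.inr l) i)) *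
    (c.1 (Γ.tail (Sum.inl b)) i / c.1 (Γ.head b) i) * c.2.1 b ^ (Γ.slope (Sum.inl b) i),
  fun j =>
    (c.1 (Γ.tail (Sum.inr j)) 0 ^ (-(Γ.slope (Sum.inr j) 1)) *
      c.1 (Γ.tail (Sum.inr j)) 1 ^ (Γ.slope (Sum.inr j) 0)) *
    ((∏ l ∈ Finset.univ.filter (fun l => Γ.Above (Γ.tail (Sum.inr j)) l),
      (c.2.2 (Sum.inr j) - c.2.2 (Γ.dir (Γ.tail (Sum.inr j)) l)) ^
        omega (Γ.slope (Sum.inr j)) (Γ.slope (Sum.inr l))) *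
    (∏ l ∈ Finset.univ.filter (fun l => ¬ Γ.Above (Γ.tail (Sum.inr j)) l),
      (-1) ^ omega (Γ.slope (Sum.inr j)) (Γ.slope (Sum.inr l))) *
    (-1) ^ omega (Γ.slope (Sum.inr j)) Γ.rootSlope))

/-- The logarithmic differential of `lead` at `c`, applied to `d`. -/
def logDiff (c d : Params V B L ℂ) : Target B L ℂ :=
  (fun b i =>
    (∑ l ∈ Finset.univ.filter
        (fun l => Γ.Above (Γ.tail (Sum.inl b)) l ∧ ¬ Γ.Above (Γ.head b) l),
      (Γ.slope (Sum.inr l) i : ℂ) *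
        ((d.2.2 (Γ.dir (Γ.tail (Sum.inl b)) l) - d.2.2 (Sum.inl b)) /
          (c.2.2 (Γ.dir (Γ.tail (Sum.inl b)) l) - c.2.2 (Sum.inl b)))) +
    (d.1 (Γ.tail (Sum.inl b)) i / c.1 (Γ.tail (Sum.inl b)) i -
      d.1 (Γ.head b) i / c.1 (Γ.head b) i) +
    (Γ.slope (Sum.inl b) i : ℂ) * (d.2.1 b / c.2.1 b),
  fun j =>
    (((-(Γ.slope (Sum.inr j) 1) : ℤ) : ℂ) *
        (d.1 (Γ.tail (Sum.inr j)) 0 / c.1 (Γ.tail (Sum.inr j)) 0) +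
      (Γ.slope (Sum.inr j) 0 : ℂ) *
        (d.1 (Γ.tail (Sum.inr j)) 1 / c.1 (Γ.tail (Sum.inr j)) 1)) +
    ∑ l ∈ Finset.univ.filter (fun l => Γ.Above (Γ.tail (Sum.inr j)) l),
      (omega (Γ.slope (Sum.inr j)) (Γ.slope (Sum.inr l)) : ℂ) *
        ((d.2.2 (Sum.inr j) - d.2.2 (Γ.dir (Γ.tail (Sum.inr j)) l)) /
          (c.2.2 (Sum.inr j) - c.2.2 (Γ.dir (Γ.tail (Sum.inr j)) l))))

/-- `p` and `p'` are congruent modulo `t ^ n`, with constant term `c` for `p` and `d` the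
coefficient of `t ^ n` in `p' - p`. -/
structure JetParams (n : ℕ) (p p' : Params V B L ℂ⟦X⟧) (c d : Params V B L ℂ) : Prop where
  chi : ∀ v i, Jet n (toL (p.1 v i)) (toL (p'.1 v i)) (c.1 v i) (d.1 v i)
  alpha : ∀ b, Jet n (toL (p.2.1 b)) (toL (p'.2.1 b)) (c.2.1 b) (d.2.1 b)
  beta : ∀ e, Jet n (toL (p.2.2 e)) (toL (p'.2.2 e)) (c.2.2 e) (d.2.2 e)

variable {Γ}

lemma tt_ne_zero : tt ≠ 0 := by simp [tt]

section Coordinates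

variable {p : Params V B L ℂ⟦X⟧}

lemma scale_head (b : B) :
    Γ.scale p (Γ.head b) = tt ^ Γ.len b * toL (p.2.1 b) * Γ.scale p (Γ.tail (Sum.inl b)) :=
  Γ.prod_ancestors_head _ b

lemma center_head (b : B) : Γ.center p (Γ.head b) =
    Γ.scale p (Γ.tail (Sum.inl b)) * toL (p.2.2 (Sum.inl b)) + Γ.center p (Γ.tail (Sum.inl b)) :=
  Γ.sum_ancestors_head _ b

lemma scale_ne_zero (hα : ∀ b, toL (p.2.1 b) ≠ 0) (w : V) : Γ.scale p w ≠ 0 :=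
  Finset.prod_ne_zero_iff.2 fun b _ => mul_ne_zero (pow_ne_zero _ tt_ne_zero) (hα b)

lemma ycoord_self (hα : ∀ b, toL (p.2.1 b) ≠ 0) (l : L) :
    Γ.ycoord p (Γ.tail (Sum.inr l)) l = toL (p.2.2 (Sum.inr l)) := by
  have := Γ.scale_ne_zero hα (Γ.tail (Sum.inr l))
  rw [ycoord]
  field_simp
  ring

lemma ycoord_tail (hα : ∀ b, toL (p.2.1 b) ≠ 0) (b : B) (l : L) :
    Γ.ycoord p (Γ.tail (Sum.inl b)) l =
      toL (p.2.2 (Sum.inl b)) + tt ^ Γ.len b * (toL (p.2.1 b) * Γ.ycoord p (Γ.head b) l) := by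
  have h1 := Γ.scale_ne_zero hα (Γ.tail (Sum.inl b))
  have h2 := hα b
  have h3 := pow_ne_zero (Γ.len b) tt_ne_zero
  rw [ycoord, ycoord, scale_head, center_head]
  field_simp
  ring

lemma ycoord_head_inv (hα : ∀ b, toL (p.2.1 b) ≠ 0) (b : B) (l : L) :
    (Γ.ycoord p (Γ.head b) l)⁻¹ = tt ^ Γ.len b *
      (toL (p.2.1 b) * (Γ.ycoord p (Γ.tail (Sum.inl b)) l - toL (p.2.2 (Sum.inl b)))⁻¹) := by
  have h2 := hα b
  have h3 := pow_ne_zero (Γ.len b) tt_ne_zero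
  rw [ycoord_tail hα, add_sub_cancel_left, mul_inv, mul_inv]
  field_simp

end Coordinates

variable {n : ℕ} {p p' : Params V B L ℂ⟦X⟧} {c d : Params V B L ℂ}

namespace JetParams

lemma alpha_ne (hn : 0 < n) (hc : Γ.Regular c) (h : JetParams n p p' c d)
    (b : B) : toL (p.2.1 b) ≠ 0 := ((h.alpha b).ne_zero hn (hc.alpha_ne b)).1

lemma alpha_ne' (hn : 0 < n) (hc : Γ.Regular c) (h : JetParams n p p' c d)
    (b : B) : toL (p'.2.1 b) ≠ 0 := ((h.alpha b).ne_zero hn (hc.alpha_ne b)).2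

lemma ycoord_through (hn : 0 < n) (hc : Γ.Regular c) (h : JetParams n p p' c d)
    [Finite V] (e : B ⊕ L) : ∀ l, Γ.Through e l →
    Jet n (Γ.ycoord p (Γ.tail e) l) (Γ.ycoord p' (Γ.tail e) l) (c.2.2 e) (d.2.2 e) := by
  induction e using Γ.leaf_induction with
  | h0 j =>
    intro l hl
    obtain rfl : l = j := hl
    rw [ycoord_self (h.alpha_ne hn hc), ycoord_self (h.alpha_ne' hn hc)]
    exact h.beta _
  | h1 b ih =>
    intro l hl
    obtain ⟨e, he, hel⟩ := TropTree.Above.exists_through hl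
    have hy := ih e he l hel
    rw [he] at hy
    rw [ycoord_tail (h.alpha_ne hn hc), ycoord_tail (h.alpha_ne' hn hc)]
    simpa using (h.beta (Sum.inl b)).add
      (((h.alpha b).mul hn hy).tt_pow_mul (Γ.len_pos b))

lemma ycoord_above (hn : 0 < n) (hc : Γ.Regular c) (h : JetParams n p p' c d)
    [Finite V] {w : V} {l : L} (hl : Γ.Above w l) :
    Jet n (Γ.ycoord p w l) (Γ.ycoord p' w l) (c.2.2 (Γ.dir w l)) (d.2.2 (Γ.dir w l)) := by
  have := h.ycoord_through hn hc (Γ.dir w l) l hl.through_dir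
  rwa [hl.tail_dir] at this

lemma ycoord_inv (hn : 0 < n) (hc : Γ.Regular c) (h : JetParams n p p' c d)
    [Finite V] {w : V} {l : L} (hl : ¬ Γ.Above w l) :
    (Γ.ycoord p w l ≠ 0 ∧ Γ.ycoord p' w l ≠ 0) ∧
      Jet n (Γ.ycoord p w l)⁻¹ (Γ.ycoord p' w l)⁻¹ 0 0 := by
  induction w using Γ.root_induction with
  | h0 => exact absurd (Γ.reachable _) hl
  | h1 b ih =>
    rw [ycoord_head_inv (h.alpha_ne hn hc), ycoord_head_inv (h.alpha_ne' hn hc)]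
    have hne : ∀ {x y : LaurentSeries ℂ}, x = y⁻¹ → x ≠ 0 → y ≠ 0 :=
      fun h1 h2 h3 => h2 (by rw [h1, h3, inv_zero])
    have hnz := fun (x x' : LaurentSeries ℂ) (hx : x ≠ 0) (hx' : x' ≠ 0) =>
      And.intro (mul_ne_zero (pow_ne_zero (Γ.len b) tt_ne_zero)
        (mul_ne_zero (h.alpha_ne hn hc b) (inv_ne_zero hx)))
        (mul_ne_zero (pow_ne_zero (Γ.len b) tt_ne_zero)
        (mul_ne_zero (h.alpha_ne' hn hc b) (inv_ne_zero hx')))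
    by_cases hl' : Γ.Above (Γ.tail (Sum.inl b)) l
    · have hy := (h.ycoord_above hn hc hl').sub (h.beta (Sum.inl b))
      have hd : c.2.2 (Γ.dir (Γ.tail (Sum.inl b)) l) - c.2.2 (Sum.inl b) ≠ 0 := by
        refine sub_ne_zero.2 (hc.beta_ne _ _ ?_ hl'.tail_dir)
        exact fun he => hl (hl'.through_iff.2 he)
      obtain ⟨hx, hx'⟩ := hy.ne_zero hn hd
      have h2 := hnz _ _ hx hx'
      exact ⟨⟨hne (ycoord_head_inv (h.alpha_ne hn hc) b l).symm h2.1,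
        hne (ycoord_head_inv (h.alpha_ne' hn hc) b l).symm h2.2⟩,
        ((h.alpha b).mul hn (hy.inv hn hd)).tt_pow_mul (Γ.len_pos b)⟩
    · obtain ⟨⟨h1, h2⟩, hy⟩ := ih hl'
      have hu := (Jet.one n).sub ((h.beta (Sum.inl b)).mul hn hy)
      have hd : (1 : ℂ) - c.2.2 (Sum.inl b) * 0 ≠ 0 := by simp
      obtain ⟨hx, hx'⟩ := hu.ne_zero hn hd
      have e1 : ∀ {y z : LaurentSeries ℂ}, y ≠ 0 → y - z = y * (1 - z * y⁻¹) := by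
        intro y z hy
        field_simp
      rw [e1 h1, e1 h2, mul_inv, mul_inv]
      have h3 := hnz _ _ (mul_ne_zero h1 hx) (mul_ne_zero h2 hx')
      refine ⟨⟨hne ?_ h3.1, hne ?_ h3.2⟩,
        ((h.alpha b).mul hn (hy.mul hn (hu.inv hn hd))).tt_pow_mul (Γ.len_pos b)⟩
      · rw [← e1 h1, ycoord_head_inv (h.alpha_ne hn hc)]
      · rw [← e1 h2, ycoord_head_inv (h.alpha_ne' hn hc)]

lemma phiEdge (hn : 0 < n) (hc : Γ.Regular c) (h : JetParams n p p' c d)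
    [Finite V] (b : B) (i : Fin 2) :
    LogJet n (Γ.phiEdge p b i) (Γ.phiEdge p' b i)
      (∏ l ∈ Finset.univ.filter
        (fun l => Γ.Above (Γ.tail (Sum.inl b)) l ∧ ¬ Γ.Above (Γ.head b) l),
      (c.2.2 (Γ.dir (Γ.tail (Sum.inl b)) l) - c.2.2 (Sum.inl b)) ^ (Γ.slope (Sum.inr l) i))
      (∑ l ∈ Finset.univ.filter
        (fun l => Γ.Above (Γ.tail (Sum.inl b)) l ∧ ¬ Γ.Above (Γ.head b) l),
      (Γ.slope (Sum.inr l) i : ℂ) *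
        ((d.2.2 (Γ.dir (Γ.tail (Sum.inl b)) l) - d.2.2 (Sum.inl b)) /
          (c.2.2 (Γ.dir (Γ.tail (Sum.inl b)) l) - c.2.2 (Sum.inl b)))) := by
  have h1 := LogJet.prod (f := fun l => (Γ.ycoord p (Γ.tail (Sum.inl b)) l -
      toL (p.2.2 (Sum.inl b))) ^ (Γ.slope (Sum.inr l) i))
    (f' := fun l => (Γ.ycoord p' (Γ.tail (Sum.inl b)) l -
      toL (p'.2.2 (Sum.inl b))) ^ (Γ.slope (Sum.inr l) i)) hn
    (Finset.univ.filter (fun l => Γ.Above (Γ.tail (Sum.inl b)) l ∧ ¬ Γ.Above (Γ.head b) l))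
    fun l hl => by
      simp only [Finset.mem_filter, Finset.mem_univ, true_and] at hl
      refine (LogJet.of_jet ((h.ycoord_above hn hc hl.1).sub (h.beta (Sum.inl b))) ?_).zpow hn _
      exact sub_ne_zero.2 (hc.beta_ne _ _ (fun he => hl.2 (hl.1.through_iff.2 he)) hl.1.tail_dir)
  have h2 := LogJet.prod (f := fun l => (1 - toL (p.2.2 (Sum.inl b)) /
      Γ.ycoord p (Γ.tail (Sum.inl b)) l) ^ (Γ.slope (Sum.inr l) i))
    (f' := fun l => (1 - toL (p'.2.2 (Sum.inl b)) /
      Γ.ycoord p' (Γ.tail (Sum.inl b)) l) ^ (Γ.slope (Sum.inr l) i)) (a := 1) (b := 0) hn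
    (Finset.univ.filter (fun l => ¬ Γ.Above (Γ.tail (Sum.inl b)) l))
    fun l hl => by
      simp only [Finset.mem_filter, Finset.mem_univ, true_and] at hl
      have := (LogJet.of_jet ((Jet.one n).sub ((h.beta (Sum.inl b)).mul hn
        (h.ycoord_inv hn hc hl).2)) (by simp)).zpow hn (Γ.slope (Sum.inr l) i)
      simpa [div_eq_mul_inv] using this
  simpa [TropCurve.phiEdge] using h1.mul hn h2

lemma phiEnd (hn : 0 < n) (hc : Γ.Regular c) (h : JetParams n p p' c d)
    [Finite V] (j : L) :
    LogJet n (Γ.phiEnd p j) (Γ.phiEnd p' j)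
      ((∏ l ∈ Finset.univ.filter (fun l => Γ.Above (Γ.tail (Sum.inr j)) l),
        (c.2.2 (Sum.inr j) - c.2.2 (Γ.dir (Γ.tail (Sum.inr j)) l)) ^
          omega (Γ.slope (Sum.inr j)) (Γ.slope (Sum.inr l))) *
      (∏ l ∈ Finset.univ.filter (fun l => ¬ Γ.Above (Γ.tail (Sum.inr j)) l),
        (-1) ^ omega (Γ.slope (Sum.inr j)) (Γ.slope (Sum.inr l))) *
      (-1) ^ omega (Γ.slope (Sum.inr j)) Γ.rootSlope)
      (∑ l ∈ Finset.univ.filter (fun l => Γ.Above (Γ.tail (Sum.inr j)) l),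
        (omega (Γ.slope (Sum.inr j)) (Γ.slope (Sum.inr l)) : ℂ) *
          ((d.2.2 (Sum.inr j) - d.2.2 (Γ.dir (Γ.tail (Sum.inr j)) l)) /
            (c.2.2 (Sum.inr j) - c.2.2 (Γ.dir (Γ.tail (Sum.inr j)) l)))) := by
  have h1 := LogJet.prod (f := fun l => (toL (p.2.2 (Sum.inr j)) -
      Γ.ycoord p (Γ.tail (Sum.inr j)) l) ^ omega (Γ.slope (Sum.inr j)) (Γ.slope (Sum.inr l)))
    (f' := fun l => (toL (p'.2.2 (Sum.inr j)) -
      Γ.ycoord p' (Γ.tail (Sum.inr j)) l) ^ omega (Γ.slope (Sum.inr j)) (Γ.slope (Sum.inr l)))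
    (a := fun l => (c.2.2 (Sum.inr j) - c.2.2 (Γ.dir (Γ.tail (Sum.inr j)) l)) ^
          omega (Γ.slope (Sum.inr j)) (Γ.slope (Sum.inr l)))
    (b := fun l => (omega (Γ.slope (Sum.inr j)) (Γ.slope (Sum.inr l)) : ℂ) *
          ((d.2.2 (Sum.inr j) - d.2.2 (Γ.dir (Γ.tail (Sum.inr j)) l)) /
            (c.2.2 (Sum.inr j) - c.2.2 (Γ.dir (Γ.tail (Sum.inr j)) l)))) hn
    (Finset.univ.filter (fun l => Γ.Above (Γ.tail (Sum.inr j)) l))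
    fun l hl => by
      simp only [Finset.mem_filter, Finset.mem_univ, true_and] at hl
      by_cases hlj : l = j
      · subst hlj
        have : omega (Γ.slope (Sum.inr l)) (Γ.slope (Sum.inr l)) = 0 := by
          rw [omega]; ring
        simpa [this] using LogJet.one n
      · refine (LogJet.of_jet ((h.beta (Sum.inr j)).sub (h.ycoord_above hn hc hl)) ?_).zpow hn _
        refine sub_ne_zero.2 (hc.beta_ne _ _ (fun he => hlj ?_) hl.tail_dir.symm)
        exact hl.through_iff.2 he.symm
  have h2 := LogJet.prod (f := fun l => (toL (p.2.2 (Sum.inr j)) /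
      Γ.ycoord p (Γ.tail (Sum.inr j)) l - 1) ^ omega (Γ.slope (Sum.inr j)) (Γ.slope (Sum.inr l)))
    (f' := fun l => (toL (p'.2.2 (Sum.inr j)) /
      Γ.ycoord p' (Γ.tail (Sum.inr j)) l - 1) ^ omega (Γ.slope (Sum.inr j)) (Γ.slope (Sum.inr l)))
    (a := fun l => (-1) ^ omega (Γ.slope (Sum.inr j)) (Γ.slope (Sum.inr l))) (b := 0) hn
    (Finset.univ.filter (fun l => ¬ Γ.Above (Γ.tail (Sum.inr j)) l))
    fun l hl => by
      simp only [Finset.mem_filter, Finset.mem_univ, true_and] at hl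
      have := (LogJet.of_jet (((h.beta (Sum.inr j)).mul hn
        (h.ycoord_inv hn hc hl).2).sub (Jet.one n)) (by simp)).zpow hn
        (omega (Γ.slope (Sum.inr j)) (Γ.slope (Sum.inr l)))
      simpa [div_eq_mul_inv] using this
  have h3 : LogJet n (-1) (-1) (-1) 0 := ⟨by simp, by simpa using (Jet.one n).neg⟩
  simpa [TropCurve.phiEnd] using (h1.mul hn h2).mul hn (h3.zpow hn (omega (Γ.slope (Sum.inr j)) Γ.rootSlope))

lemma theta_edge (hn : 0 < n) (hc : Γ.Regular c) (h : JetParams n p p' c d)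
    [Finite V] (b : B) (i : Fin 2) :
    LogJet n ((Γ.theta p).1 b i) ((Γ.theta p').1 b i)
      ((Γ.lead c).1 b i) ((Γ.logDiff c d).1 b i) :=
  ((h.phiEdge hn hc b i).mul hn ((LogJet.of_jet (h.chi _ i) (hc.chi_ne _ i)).div hn
    (LogJet.of_jet (h.chi _ i) (hc.chi_ne _ i)))).mul hn
    ((LogJet.of_jet (h.alpha b) (hc.alpha_ne b)).zpow hn _)

lemma theta_end (hn : 0 < n) (hc : Γ.Regular c) (h : JetParams n p p' c d)
    [Finite V] (j : L) :
    LogJet n ((Γ.theta p).2 j) ((Γ.theta p').2 j) ((Γ.lead c).2 j) ((Γ.logDiff c d).2 j) :=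
  (((LogJet.of_jet (h.chi _ 0) (hc.chi_ne _ 0)).zpow hn _).mul hn
    ((LogJet.of_jet (h.chi _ 1) (hc.chi_ne _ 1)).zpow hn _)).mul hn (h.phiEnd hn hc j)

end JetParams

end TropCurve

lemma toL_coeff_zero (f : ℂ⟦X⟧) : (toL f).coeff 0 = PowerSeries.constantCoeff f := by
  simpa [toL] using HahnSeries.ofPowerSeries_apply_coeff (Γ := ℤ) f 0

lemma Jet.coeff_zero {n : ℕ} {F F' : LaurentSeries ℂ} {a d : ℂ} (h : Jet n F F' a d) :
    F.coeff 0 = a := by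
  obtain ⟨f, g, rfl, -, rfl, -⟩ := h
  exact toL_coeff_zero f

/-- `f` is differentiable at `x`, with `f x ≠ 0` and logarithmic differential `g`. -/
def HasLogDiffAt {E : Type*} [NormedAddCommGroup E] [NormedSpace ℂ E] (f g : E → ℂ) (x : E) :
    Prop :=
  f x ≠ 0 ∧ ∃ l : E →L[ℂ] ℂ, (∀ d, l d = g d) ∧ HasFDerivAt f (f x • l) x

namespace HasLogDiffAt

variable {E : Type*} [NormedAddCommGroup E] [NormedSpace ℂ E] {f g f' g' : E → ℂ} {x : E}

lemma of_clm (l : E →L[ℂ] ℂ) (hx : l x ≠ 0) : HasLogDiffAt l (fun d => l d / l x) x := by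
  refine ⟨hx, (l x)⁻¹ • l, fun d => ?_, ?_⟩
  · simp [div_eq_inv_mul]
  · rw [smul_smul, mul_inv_cancel₀ hx, one_smul]
    exact l.hasFDerivAt

lemma const {a : ℂ} (ha : a ≠ 0) : HasLogDiffAt (fun _ : E => a) (fun _ => 0) x :=
  ⟨ha, 0, fun _ => rfl, (hasFDerivAt_const a x).congr_fderiv (by ext; simp)⟩

lemma mul (h : HasLogDiffAt f g x) (h' : HasLogDiffAt f' g' x) :
    HasLogDiffAt (fun y => f y * f' y) (fun d => g d + g' d) x := by
  obtain ⟨h0, l, hl, h⟩ := h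
  obtain ⟨h0', l', hl', h'⟩ := h'
  refine ⟨mul_ne_zero h0 h0', l + l', fun d => by simp [hl, hl'], ?_⟩
  refine (h.mul h').congr_fderiv ?_
  ext d
  simp
  ring

lemma inv (h : HasLogDiffAt f g x) : HasLogDiffAt (fun y => (f y)⁻¹) (fun d => -g d) x := by
  obtain ⟨h0, l, hl, h⟩ := h
  refine ⟨inv_ne_zero h0, -l, fun d => by simp [hl], ?_⟩
  refine ((hasDerivAt_inv h0).comp_hasFDerivAt x h).congr_fderiv ?_
  ext d
  simp
  field_simp

lemma div (h : HasLogDiffAt f g x) (h' : HasLogDiffAt f' g' x) :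
    HasLogDiffAt (fun y => f y / f' y) (fun d => g d - g' d) x := by
  simpa only [div_eq_mul_inv, sub_eq_add_neg] using h.mul h'.inv

lemma pow (h : HasLogDiffAt f g x) (k : ℕ) :
    HasLogDiffAt (fun y => f y ^ k) (fun d => k * g d) x := by
  induction k with
  | zero => simpa using const one_ne_zero
  | succ k ih =>
    convert ih.mul h using 2
    · rw [pow_succ]
    · push_cast; ring

lemma zpow (h : HasLogDiffAt f g x) (k : ℤ) :
    HasLogDiffAt (fun y => f y ^ k) (fun d => k * g d) x := by
  rcases k with k | k
  · simpa using h.pow k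
  · simpa only [zpow_negSucc, Int.cast_negSucc, neg_mul] using (h.pow (k + 1)).inv

lemma prod {ι : Type*} {f g : ι → E → ℂ} (s : Finset ι)
    (h : ∀ i ∈ s, HasLogDiffAt (f i) (g i) x) :
    HasLogDiffAt (fun y => ∏ i ∈ s, f i y) (fun d => ∑ i ∈ s, g i d) x := by
  induction s using Finset.induction_on with
  | empty => simpa using const one_ne_zero
  | insert i s hi ih =>
    simp only [Finset.prod_insert hi, Finset.sum_insert hi]
    exact (h i (by simp)).mul (ih fun j hj => h j (by simp [hj]))

end HasLogDiffAt

namespace TropCurve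

variable {V B L : Type} [Fintype V] [Fintype B] [Fintype L] {Γ : TropCurve V B L}

section Functionals

variable (V B L)

/-- The coordinate `χ_{v,i}`. -/
def chiL (v : V) (i : Fin 2) : Params V B L ℂ →L[ℂ] ℂ :=
  (ContinuousLinearMap.proj (R := ℂ) (φ := fun _ : Fin 2 => ℂ) i).comp
    ((ContinuousLinearMap.proj (R := ℂ) (φ := fun _ : V => Fin 2 → ℂ) v).comp
      (ContinuousLinearMap.fst ℂ (V → Fin 2 → ℂ) ((B → ℂ) × (B ⊕ L → ℂ))))

/-- The coordinate `α_b`. -/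
def alphaL (b : B) : Params V B L ℂ →L[ℂ] ℂ :=
  (ContinuousLinearMap.proj (R := ℂ) (φ := fun _ : B => ℂ) b).comp
    ((ContinuousLinearMap.fst ℂ (B → ℂ) (B ⊕ L → ℂ)).comp
      (ContinuousLinearMap.snd ℂ (V → Fin 2 → ℂ) ((B → ℂ) × (B ⊕ L → ℂ))))

/-- The coordinate `β_e`. -/
def betaL (e : B ⊕ L) : Params V B L ℂ →L[ℂ] ℂ :=
  (ContinuousLinearMap.proj (R := ℂ) (φ := fun _ : B ⊕ L => ℂ) e).comp
    ((ContinuousLinearMap.snd ℂ (B → ℂ) (B ⊕ L → ℂ)).comp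
      (ContinuousLinearMap.snd ℂ (V → Fin 2 → ℂ) ((B → ℂ) × (B ⊕ L → ℂ))))

end Functionals

variable {c : Params V B L ℂ}

lemma hasLogDiffAt_lead_edge (hc : Γ.Regular c) (b : B) (i : Fin 2) :
    HasLogDiffAt (fun c => (Γ.lead c).1 b i) (fun d => (Γ.logDiff c d).1 b i) c := by
  have hchi : ∀ v i, HasLogDiffAt (fun c : Params V B L ℂ => c.1 v i)
      (fun d => d.1 v i / c.1 v i) c :=
    fun v i => HasLogDiffAt.of_clm (chiL V B L v i) (hc.chi_ne v i)
  have hα : HasLogDiffAt (fun c : Params V B L ℂ => c.2.1 b) (fun d => d.2.1 b / c.2.1 b) c :=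
    HasLogDiffAt.of_clm (alphaL V B L b) (hc.alpha_ne b)
  refine ((HasLogDiffAt.prod _ fun l hl => HasLogDiffAt.zpow ?_ _).mul
    ((hchi _ i).div (hchi _ i))).mul (hα.zpow _)
  simp only [Finset.mem_filter, Finset.mem_univ, true_and] at hl
  exact HasLogDiffAt.of_clm (betaL V B L _ - betaL V B L _) (sub_ne_zero.2
    (hc.beta_ne _ _ (fun he => hl.2 (hl.1.through_iff.2 he)) hl.1.tail_dir))

lemma hasLogDiffAt_lead_end (hc : Γ.Regular c) (j : L) :
    HasLogDiffAt (fun c => (Γ.lead c).2 j) (fun d => (Γ.logDiff c d).2 j) c := by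
  have hchi : ∀ v i, HasLogDiffAt (fun c : Params V B L ℂ => c.1 v i)
      (fun d => d.1 v i / c.1 v i) c :=
    fun v i => HasLogDiffAt.of_clm (chiL V B L v i) (hc.chi_ne v i)
  have h1 : ∀ k : ℤ, (-1 : ℂ) ^ k ≠ 0 := fun k => zpow_ne_zero k (by simp)
  have h2 : HasLogDiffAt (fun c : Params V B L ℂ =>
      ∏ l ∈ Finset.univ.filter (fun l => Γ.Above (Γ.tail (Sum.inr j)) l),
        (c.2.2 (Sum.inr j) - c.2.2 (Γ.dir (Γ.tail (Sum.inr j)) l)) ^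
          omega (Γ.slope (Sum.inr j)) (Γ.slope (Sum.inr l)))
      (fun d => ∑ l ∈ Finset.univ.filter (fun l => Γ.Above (Γ.tail (Sum.inr j)) l),
        (omega (Γ.slope (Sum.inr j)) (Γ.slope (Sum.inr l)) : ℂ) *
          ((d.2.2 (Sum.inr j) - d.2.2 (Γ.dir (Γ.tail (Sum.inr j)) l)) /
            (c.2.2 (Sum.inr j) - c.2.2 (Γ.dir (Γ.tail (Sum.inr j)) l)))) c := by
    refine HasLogDiffAt.prod _ fun l hl => ?_
    simp only [Finset.mem_filter, Finset.mem_univ, true_and] at hl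
    by_cases hlj : l = j
    · subst hlj
      have : omega (Γ.slope (Sum.inr l)) (Γ.slope (Sum.inr l)) = 0 := by
        rw [omega]; ring
      simpa [this] using HasLogDiffAt.const (E := Params V B L ℂ) (x := c) one_ne_zero
    · refine HasLogDiffAt.zpow (HasLogDiffAt.of_clm (betaL V B L _ - betaL V B L _) ?_) _
      refine sub_ne_zero.2 (hc.beta_ne _ _ (fun he => hlj ?_) hl.tail_dir.symm)
      exact hl.through_iff.2 he.symm
  have h4 : ∏ l ∈ Finset.univ.filter (fun l => ¬ Γ.Above (Γ.tail (Sum.inr j)) l),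
      (-1 : ℂ) ^ omega (Γ.slope (Sum.inr j)) (Γ.slope (Sum.inr l)) ≠ 0 :=
    Finset.prod_ne_zero_iff.2 fun l _ => h1 _
  have h3 := ((h2.mul (HasLogDiffAt.const h4)).mul
    (HasLogDiffAt.const (h1 (omega (Γ.slope (Sum.inr j)) Γ.rootSlope))))
  simp only [add_zero] at h3
  exact (((hchi _ 0).zpow _).mul ((hchi _ 1).zpow _)).mul h3

lemma Regular.eventually (hc : Γ.Regular c) : ∀ᶠ x in nhds c, Γ.Regular x := by
  have h1 : ∀ᶠ x : Params V B L ℂ in nhds c, ∀ v i, x.1 v i ≠ 0 := by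
    simp only [Filter.eventually_all]
    exact fun v i => (chiL V B L v i).continuous.continuousAt.eventually_ne (hc.chi_ne v i)
  have h2 : ∀ᶠ x : Params V B L ℂ in nhds c, ∀ b, x.2.1 b ≠ 0 := by
    simp only [Filter.eventually_all]
    exact fun b => (alphaL V B L b).continuous.continuousAt.eventually_ne (hc.alpha_ne b)
  have h3 : ∀ᶠ x : Params V B L ℂ in nhds c,
      ∀ e e', e ≠ e' → Γ.tail e = Γ.tail e' → x.2.2 e ≠ x.2.2 e' := by
    simp only [Filter.eventually_all]
    intro e e' h h'
    have := (betaL V B L e - betaL V B L e').continuous.continuousAt.eventually_ne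
      (sub_ne_zero.2 (hc.beta_ne e e' h h') : (betaL V B L e - betaL V B L e') c ≠ 0)
    exact this.mono fun x hx => sub_ne_zero.1 hx
  filter_upwards [h1, h2, h3] with x h1 h2 h3 using ⟨h1, h2, h3⟩

lemma thetaZero_eq_lead (hc : Γ.Regular c) : Γ.thetaZero c = Γ.lead c := by
  have h : JetParams 1 ((fun v i => PowerSeries.C (c.1 v i), fun b => PowerSeries.C (c.2.1 b),
      fun e => PowerSeries.C (c.2.2 e)) : Params V B L ℂ⟦X⟧)
      (fun v i => PowerSeries.C (c.1 v i), fun b => PowerSeries.C (c.2.1 b),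
      fun e => PowerSeries.C (c.2.2 e)) c 0 := by
    refine ⟨fun v i => ?_, fun b => ?_, fun e => ?_⟩
    · simpa using Jet.const_self 1 (PowerSeries.C (c.1 v i))
    · simpa using Jet.const_self 1 (PowerSeries.C (c.2.1 b))
    · simpa using Jet.const_self 1 (PowerSeries.C (c.2.2 e))
  refine Prod.ext ?_ ?_
  · funext b i
    exact Jet.coeff_zero (h.theta_edge one_pos hc b i).2
  · funext j
    exact Jet.coeff_zero (h.theta_end one_pos hc j).2

lemma exists_hasFDerivAt_thetaZero (hc : Γ.Regular c) :
    ∃ D : Params V B L ℂ →L[ℂ] Target B L ℂ, HasFDerivAt Γ.thetaZero D c ∧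
      ∀ d, D d = Γ.lead c * Γ.logDiff c d := by
  choose l hl hd using fun b i => (hasLogDiffAt_lead_edge hc b i).2
  choose l' hl' hd' using fun j => (hasLogDiffAt_lead_end hc j).2
  refine ⟨(ContinuousLinearMap.pi fun b => ContinuousLinearMap.pi fun i =>
    (Γ.lead c).1 b i • l b i).prod (ContinuousLinearMap.pi fun j => (Γ.lead c).2 j • l' j), ?_, ?_⟩
  · have h1 : HasFDerivAt Γ.lead ((ContinuousLinearMap.pi fun b => ContinuousLinearMap.pi fun i =>
        (Γ.lead c).1 b i • l b i).prod
        (ContinuousLinearMap.pi fun j => (Γ.lead c).2 j • l' j)) c := by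
      refine HasFDerivAt.prodMk (f₁ := fun c => (Γ.lead c).1) (f₂ := fun c => (Γ.lead c).2) ?_ ?_
      · exact hasFDerivAt_pi.2 fun b => hasFDerivAt_pi.2 fun i => hd b i
      · exact hasFDerivAt_pi.2 fun j => hd' j
    exact h1.congr_of_eventuallyEq (hc.eventually.mono fun x hx => thetaZero_eq_lead hx)
  · intro d
    refine Prod.ext ?_ ?_
    · funext b i
      simp [hl]
    · funext j
      simp [hl']

lemma Regular.lead_ne (hc : Γ.Regular c) :
    (∀ b i, (Γ.lead c).1 b i ≠ 0) ∧ ∀ j, (Γ.lead c).2 j ≠ 0 :=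
  ⟨fun b i => (hasLogDiffAt_lead_edge hc b i).1, fun j => (hasLogDiffAt_lead_end hc j).1⟩

end TropCurve

/-- A nonzero integral form which vanishes on the vectors of moments `(ω(ν_j, e_i))_j`, and
`(1_{j ∈ S} ω(ν_j, ∑_{l ∈ S} ν_l))_j` for `S ∈ 𝒮`. -/
structure KillsMoments {L : Type} [Fintype L] (ν : L → LatN) (𝒮 : Finset (Finset L))
    (c : L → ℤ) : Prop where
  ne_zero : c ≠ 0
  translation : ∀ i, ∑ j, c j * ν j i = 0
  stretching : ∀ S ∈ 𝒮, ∑ j ∈ S, c j * omega (ν j) (∑ l ∈ S, ν l) = 0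

/-- A finite set of forms, one for each family of sets of ends whose vectors of moments are all
killed by a nonzero form. -/
def genericForms {L : Type} [Fintype L] (ν : L → LatN) : Finset (L → ℤ) :=
  (Finset.univ.filter fun 𝒮 => ∃ c, KillsMoments ν 𝒮 c).image
    fun 𝒮 => if h : ∃ c, KillsMoments ν 𝒮 c then h.choose else 0

lemma exists_mem_genericForms {L : Type} [Fintype L] {ν : L → LatN} {𝒮 : Finset (Finset L)}
    (h : ∃ c, KillsMoments ν 𝒮 c) : ∃ c ∈ genericForms ν, KillsMoments ν 𝒮 c := by
  refine ⟨h.choose, ?_, h.choose_spec⟩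
  refine Finset.mem_image.2 ⟨𝒮, by simpa using h, dif_pos h⟩

lemma zero_notMem_genericForms {L : Type} [Fintype L] (ν : L → LatN) : 0 ∉ genericForms ν := by
  intro h
  obtain ⟨𝒮, h𝒮, h0⟩ := Finset.mem_image.1 h
  have h𝒮 : ∃ c, KillsMoments ν 𝒮 c := by simpa using h𝒮
  rw [dif_pos h𝒮] at h0
  exact h𝒮.choose_spec.ne_zero h0

lemma omega_add_right (u v w : LatN) : omega u (v + w) = omega u v + omega u w := by
  simp only [omega, Pi.add_apply]
  ring

lemma omega_smul_right (u v : LatN) (k : ℕ) : omega u (k • v) = k * omega u v := by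
  simp only [omega, Pi.smul_apply, nsmul_eq_mul]
  ring

lemma omega_sum_right {ι : Type*} (u : LatN) (s : Finset ι) (v : ι → LatN) :
    omega u (∑ i ∈ s, v i) = ∑ i ∈ s, omega u (v i) := by
  simp only [omega, Finset.sum_apply, Finset.mul_sum, Finset.sum_sub_distrib]

/-- A nonzero complex solution of an integral linear system yields an integral one. -/
lemma exists_int_solution {ι κ : Type*} [Fintype ι] (A : κ → ι → ℤ) (c : ι → ℂ) (hc : c ≠ 0)
    (h : ∀ k, ∑ i, c i * A k i = 0) : ∃ c' : ι → ℤ, c' ≠ 0 ∧ ∀ k, ∑ i, c' i * A k i = 0 := by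
  obtain ⟨i₀, hi₀⟩ := Function.ne_iff.1 hc
  obtain ⟨φ, hφ⟩ : ∃ φ : Module.Dual ℚ ℂ, φ (c i₀) ≠ 0 := by
    by_contra! hφ
    exact hi₀ ((Module.forall_dual_apply_eq_zero_iff ℚ (c i₀)).1 hφ)
  obtain ⟨b, hb⟩ := IsLocalization.exist_integer_multiples_of_finite (nonZeroDivisors ℤ)
    (fun i => φ (c i))
  choose c' hc' using hb
  have hc'' : ∀ i, (c' i : ℚ) = (b : ℤ) * φ (c i) := fun i => by
    simpa [Algebra.smul_def] using hc' i
  have hb0 : ((b : ℤ) : ℚ) ≠ 0 := by exact_mod_cast nonZeroDivisors.ne_zero b.2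
  refine ⟨c', fun h0 => ?_, fun k => ?_⟩
  · have := hc'' i₀
    rw [h0, Pi.zero_apply, Int.cast_zero] at this
    exact mul_ne_zero hb0 hφ this.symm
  · have h1 : ∑ i, φ (c i) * (A k i : ℚ) = 0 := by
      rw [← map_zero φ, ← h k, map_sum]
      refine Finset.sum_congr rfl fun i _ => ?_
      have : c i * (A k i : ℂ) = (A k i : ℚ) • c i := by
        rw [Algebra.smul_def]
        simp [mul_comm]
      rw [this, map_smul, smul_eq_mul, mul_comm]
    have h2 : ((∑ i, c' i * A k i : ℤ) : ℚ) = 0 := by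
      push_cast
      simp only [hc'', mul_assoc]
      rw [← Finset.mul_sum, h1, mul_zero]
    exact_mod_cast h2

/-- The pairing `ω(n, ·)` on `N ⊗ ℂ`. -/
def omegaC (n : LatN) : (Fin 2 → ℂ) →ₗ[ℂ] ℂ :=
  (n 0 : ℂ) • LinearMap.proj 1 - (n 1 : ℂ) • LinearMap.proj 0

lemma omegaC_apply (n : LatN) (x : Fin 2 → ℂ) : omegaC n x = n 0 * x 1 - n 1 * x 0 := rfl

/-- The image in `N ⊗ ℂ` of an element of `N`. -/
def toC (n : LatN) : Fin 2 → ℂ := fun i => n i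

lemma omegaC_toC (n n' : LatN) : omegaC n (toC n') = omega n n' := by
  simp [omegaC_apply, toC, omega]

namespace TropCurve

variable {V B L : Type} [Fintype B] [Fintype L] (Γ : TropCurve V B L)

/-- The moments of the ends, as a linear function of the position of the root and of the lengths of
the bounded edges. -/
def momentMap : (Fin 2 → ℂ) × (B → ℂ) →ₗ[ℂ] (L → ℂ) :=
  LinearMap.pi fun j => omegaC (Γ.slope (Sum.inr j)) ∘ₗ (LinearMap.fst ℂ _ _ +
    ∑ b ∈ Finset.univ.filter (fun b => Γ.Le (Γ.head b) (Γ.tail (Sum.inr j))),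
      (LinearMap.toSpanSingleton ℂ (Fin 2 → ℂ) (toC (Γ.slope (Sum.inl b)))) ∘ₗ
        LinearMap.proj b ∘ₗ LinearMap.snd ℂ (Fin 2 → ℂ) (B → ℂ))

lemma momentMap_apply (x : Fin 2 → ℂ) (a : B → ℂ) (j : L) :
    Γ.momentMap (x, a) j = omegaC (Γ.slope (Sum.inr j)) (x +
      ∑ b ∈ Finset.univ.filter (fun b => Γ.Le (Γ.head b) (Γ.tail (Sum.inr j))),
        a b • toC (Γ.slope (Sum.inl b))) := by
  simp [momentMap, LinearMap.sum_apply]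

/-- The set of ends accessible from the head of a bounded edge. -/
def endsAbove (b : B) : Finset L := Finset.univ.filter (Γ.Above (Γ.head b))

lemma slope_bounded [Finite V] (b : B) :
    Γ.slope (Sum.inl b) = ∑ l ∈ Γ.endsAbove b, Γ.slope (Sum.inr l) := Γ.slope_eq_sum _

lemma sum_mul_moment_eq_zero [Finite V] {c : L → ℤ}
    (hc : KillsMoments (fun j => Γ.slope (Sum.inr j)) (Finset.univ.image Γ.endsAbove) c) :
    ∑ j, c j * Γ.moment j = 0 := by
  have h1 : ∀ j, c j * Γ.moment j = (c j * Γ.slope (Sum.inr j) 0) * Γ.pos Γ.root 1 -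
      (c j * Γ.slope (Sum.inr j) 1) * Γ.pos Γ.root 0 +
      ∑ b, if j ∈ Γ.endsAbove b then
        Γ.len b * (c j * omega (Γ.slope (Sum.inr j)) (∑ l ∈ Γ.endsAbove b, Γ.slope (Sum.inr l)))
        else 0 := by
    intro j
    rw [moment, Γ.pos_eq, omega_add_right, omega_sum_right, mul_add, Finset.mul_sum,
      ← Finset.sum_filter]
    congr 1
    · rw [omega]; ring
    · refine Finset.sum_congr ?_ fun b _ => ?_
      · ext b
        simp [endsAbove, TropTree.Above]
      · rw [omega_smul_right, ← slope_bounded]; ring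
  simp only [h1, Finset.sum_add_distrib, Finset.sum_sub_distrib]
  rw [← Finset.sum_mul, ← Finset.sum_mul, hc.translation, hc.translation, Finset.sum_comm]
  simp only [zero_mul, sub_zero, zero_add, Finset.sum_ite_mem, Finset.univ_inter,
    ← Finset.mul_sum]
  refine Finset.sum_eq_zero fun b _ => ?_
  rw [hc.stretching _ (Finset.mem_image_of_mem _ (Finset.mem_univ b)), mul_zero]

variable {Γ}

lemma momentMap_surjective [Finite V]
    (hμ : ∀ c ∈ genericForms (fun j => Γ.slope (Sum.inr j)), ∑ j, c j * Γ.moment j ≠ 0) :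
    Function.Surjective Γ.momentMap := by
  have hno : ¬ ∃ c, KillsMoments (fun j => Γ.slope (Sum.inr j))
      (Finset.univ.image Γ.endsAbove) c := by
    intro h
    obtain ⟨c, hc, hk⟩ := exists_mem_genericForms h
    exact hμ c hc (Γ.sum_mul_moment_eq_zero hk)
  rw [← LinearMap.range_eq_top]
  by_contra hr
  obtain ⟨f, hf, hle⟩ := Submodule.exists_le_ker_of_lt_top _ (lt_top_iff_ne_top.2 hr)
  have hker : ∀ y, f (Γ.momentMap y) = 0 := fun y => hle (LinearMap.mem_range_self _ y)
  set c : L → ℂ := fun j => f (Pi.single j 1) with hc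
  have hfc : ∀ y, f y = ∑ j, c j * y j := by
    intro y
    rw [LinearMap.pi_apply_eq_sum_univ f y]
    refine Finset.sum_congr rfl fun j _ => ?_
    rw [smul_eq_mul, mul_comm, hc]
    congr 2
    ext k
    simp [Pi.single_apply, eq_comm]
  have hc0 : c ≠ 0 := by
    intro h0
    refine hf (LinearMap.ext fun y => ?_)
    simp [hfc, h0]
  let A : Fin 2 ⊕ B → L → ℤ := Sum.elim (fun i j => Γ.slope (Sum.inr j) i)
    (fun b j => if j ∈ Γ.endsAbove b then
      omega (Γ.slope (Sum.inr j)) (Γ.slope (Sum.inl b)) else 0)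
  have hA : ∀ k, ∑ j, c j * A k j = 0 := by
    rintro (i | b)
    · fin_cases i
      · have := hker (Pi.single 1 1, 0)
        simpa [A, hfc, momentMap_apply, omegaC_apply] using this
      · have := hker (Pi.single 0 1, 0)
        simpa [A, hfc, momentMap_apply, omegaC_apply] using this
    · have := hker (0, Pi.single b 1)
      rw [hfc] at this
      rw [← this]
      refine Finset.sum_congr rfl fun j _ => ?_
      rw [momentMap_apply]
      congr 1
      by_cases hj : Γ.Le (Γ.head b) (Γ.tail (Sum.inr j))
      · have hj' : j ∈ Γ.endsAbove b := by simpa [endsAbove, TropTree.Above] using hj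
        rw [Finset.sum_eq_single b]
        · simp [A, hj', omegaC_toC]
        · intro b' _ hb'
          simp [hb']
        · simp [hj]
      · have hj' : j ∉ Γ.endsAbove b := by simpa [endsAbove, TropTree.Above] using hj
        rw [Finset.sum_eq_zero]
        · simp [A, hj']
        · intro b' hb'
          have : b' ≠ b := by
            rintro rfl
            exact hj (by simpa using hb')
          simp [this]
  obtain ⟨c', hc', hs⟩ := exists_int_solution A c hc0 hA
  refine hno ⟨c', hc', fun i => hs (Sum.inl i), fun S hS => ?_⟩
  obtain ⟨b, -, rfl⟩ := Finset.mem_image.1 hS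
  have := hs (Sum.inr b)
  simpa only [A, Sum.elim_inr, mul_ite, mul_zero, Finset.sum_ite_mem, Finset.univ_inter,
    slope_bounded] using this

lemma card_ends_le (h : Function.Surjective Γ.momentMap) :
    Fintype.card L ≤ Fintype.card B + 2 := by
  have := LinearMap.finrank_le_finrank_of_surjective h
  simpa [add_comm] using this

lemma momentMap_bijective [Fintype V] (h : Function.Surjective Γ.momentMap) :
    Function.Bijective Γ.momentMap := by
  refine ⟨(LinearMap.injective_iff_surjective_of_finrank_eq_finrank ?_).2 h, h⟩
  have := le_antisymm (Γ.card_ends_le h) Γ.card_bounded_add_two_le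
  simp [this, add_comm]

end TropCurve

lemma not_isPrimitive_two_nsmul (n : LatN) : ¬ IsPrimitive (2 • n) := by
  rintro ⟨a, b, h⟩
  simp only [Pi.smul_apply, nsmul_eq_mul, Nat.cast_ofNat] at h
  have : 2 * (a * n 0 + b * n 1) = 1 := by linarith
  omega

lemma two_nsmul_mem_doubledDegree {Δ : Multiset LatN} (hprim : ∀ n ∈ Δ, IsPrimitive n)
    {n₁ n : LatN} {s : ℕ} (h : 2 • n ∈ doubledDegree Δ n₁ s) : n = n₁ := by
  rcases Multiset.mem_add.1 h with h | h
  · exact absurd (hprim _ (Multiset.mem_of_le (Multiset.sub_le_self _ _) h))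
      (not_isPrimitive_two_nsmul n)
  · exact smul_right_injective LatN (two_ne_zero (α := ℕ)) (Multiset.eq_of_mem_replicate h)

namespace RealStructure

variable {V B L : Type} [Fintype B] [Fintype L] {Γ : TropCurve V B L} (σ : RealStructure Γ)

lemma le_map {u w : V} (h : Γ.Le u w) : Γ.Le (σ.sV u) (σ.sV w) := by
  refine Relation.ReflTransGen.lift σ.sV ?_ _ _ h
  rintro _ _ ⟨b, rfl, rfl⟩
  exact ⟨σ.sB b, σ.tail_comm (Sum.inl b), σ.head_comm b⟩

/-- A real edge such that some non-real end leaves the same vertex. -/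
def Free (e : B ⊕ L) : Prop :=
  σ.sE e = e ∧ ∃ j, σ.sL j ≠ j ∧ Γ.tail (Sum.inr j) = Γ.tail e

variable {σ}

/-- If all the non-real ends have the same slope, then the non-real edges are ends. -/
lemma sB_eq_self [Finite V] {n₁ : LatN}
    (hn₁ : ∀ l, σ.sL l ≠ l → Γ.slope (Sum.inr l) = n₁) (hflat : Γ.NoFlat) (b : B) :
    σ.sB b = b := by
  by_contra hb
  have hnr : ∀ l, Γ.Above (Γ.head b) l → Γ.slope (Sum.inr l) = n₁ := by
    intro l hl
    refine hn₁ l fun hreal => hb ?_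
    have h1 : Γ.Le (σ.sV (Γ.head b)) (Γ.tail (Sum.inr l)) := by
      have h2 := σ.tail_comm (Sum.inr l)
      rw [Sum.map_inr, hreal] at h2
      rw [h2]
      exact σ.le_map hl
    have h2 : σ.sV (Γ.head b) = Γ.head b := by
      rcases h1.total hl with h | h
      · have h' := σ.le_map h
        rw [σ.sV_sV] at h'
        exact h.antisymm h'
      · have h' := σ.le_map h
        rw [σ.sV_sV] at h'
        exact h'.antisymm h
    rw [← σ.head_comm] at h2
    exact Γ.head_injective h2
  have hslope : ∀ e, Γ.tail e = Γ.head b → ∃ k : ℕ, Γ.slope e = k • n₁ := by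
    intro e he
    refine ⟨(Finset.univ.filter (fun l => Γ.Through e l)).card, ?_⟩
    rw [Γ.slope_eq_sum, ← Finset.sum_const]
    refine Finset.sum_congr rfl fun l hl => hnr l (he ▸ TropTree.Through.above ?_)
    simpa using hl
  obtain ⟨e, e', he, he', h⟩ := hflat (Γ.head b)
  obtain ⟨k, hk⟩ := hslope e he
  obtain ⟨k', hk'⟩ := hslope e' he'
  refine h ?_
  rw [hk, hk', omega]
  simp only [Pi.smul_apply, nsmul_eq_mul]
  ring

lemma sV_eq_self (hB : ∀ b, σ.sB b = b) (v : V) : σ.sV v = v := by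
  rcases Γ.eq_root_or_head v with rfl | ⟨b, rfl⟩
  · exact σ.sV_root
  · rw [← σ.head_comm, hB]

lemma tail_sE (hB : ∀ b, σ.sB b = b) (e : B ⊕ L) : Γ.tail (σ.sE e) = Γ.tail e :=
  (σ.tail_comm e).trans (sV_eq_self hB _)

/-- The position of the non-real edges in a curve obtained from a trivalent one: they are ends, and
one real edge and one pair of exchanged ends leave each vertex adjacent to a non-real end. -/
structure Simple (σ : RealStructure Γ) : Prop where
  sB_eq : ∀ b, σ.sB b = b
  vertex : ∀ v, (∃ e e', σ.sE e = e ∧ σ.sE e' = e' ∧ ∀ f, Γ.tail f = v → f = e ∨ f = e') ∨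
    ∃ r j, σ.Free r ∧ Γ.tail r = v ∧ σ.sL j ≠ j ∧ Γ.tail (Sum.inr j) = v ∧
      omega (Γ.slope (Sum.inr j)) (Γ.slope r) ≠ 0 ∧
      ∀ f, Γ.tail f = v → f = r ∨ f = Sum.inr j ∨ f = Sum.inr (σ.sL j)

namespace Simple

lemma sV_eq (h : σ.Simple) (v : V) : σ.sV v = v := sV_eq_self h.sB_eq v

lemma tail_sL (h : σ.Simple) (j : L) : Γ.tail (Sum.inr (σ.sL j)) = Γ.tail (Sum.inr j) :=
  tail_sE h.sB_eq (Sum.inr j)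

/-- The edges at a vertex adjacent to a non-real end. -/
lemma at_nonreal (h : σ.Simple) {j : L} (hj : σ.sL j ≠ j) :
    ∃ r, σ.Free r ∧ Γ.tail r = Γ.tail (Sum.inr j) ∧
    omega (Γ.slope (Sum.inr j)) (Γ.slope r) ≠ 0 ∧
    ∀ f, Γ.tail f = Γ.tail (Sum.inr j) → f = r ∨ f = Sum.inr j ∨ f = Sum.inr (σ.sL j) := by
  have hnr : ∀ e, σ.sE e = e → Sum.inr j ≠ e := by
    rintro e he rfl
    exact hj (Sum.inr_injective he)
  rcases h.vertex (Γ.tail (Sum.inr j)) with ⟨e, e', he, he', hf⟩ | ⟨r, k, hr, h1, h2, h3, h4, hf⟩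
  · rcases hf _ rfl with h1 | h1
    · exact absurd h1 (hnr e he)
    · exact absurd h1 (hnr e' he')
  · refine ⟨r, hr, h1, ?_⟩
    rcases hf _ rfl with h5 | h5 | h5
    · exact absurd h5 (hnr r hr.1)
    · obtain rfl := Sum.inr_injective h5
      exact ⟨h4, hf⟩
    · obtain rfl := Sum.inr_injective h5
      refine ⟨?_, fun f hf' => ?_⟩
      · have := σ.slope_comm (Sum.inr k)
        rw [Sum.map_inr] at this
        rwa [this]
      · rw [σ.sL_sL]
        rcases hf f hf' with h6 | h6 | h6
        · exact Or.inl h6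
        · exact Or.inr (Or.inr h6)
        · exact Or.inr (Or.inl h6)

lemma eq_of_free (h : σ.Simple) {r : B ⊕ L} (hr : σ.Free r) {j : L} (hj : σ.sL j ≠ j)
    (ht : Γ.tail (Sum.inr j) = Γ.tail r) :
    omega (Γ.slope (Sum.inr j)) (Γ.slope r) ≠ 0 ∧
    ∀ f, Γ.tail f = Γ.tail r → f = r ∨ f = Sum.inr j ∨ f = Sum.inr (σ.sL j) := by
  obtain ⟨r', hr', h1, h2, h3⟩ := h.at_nonreal hj
  have : r = r' := by
    rcases h3 r ht.symm with h4 | h4 | h4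
    · exact h4
    · have := hr.1
      rw [h4] at this
      exact absurd (Sum.inr_injective this) hj
    · have := hr.1
      rw [h4] at this
      have := Sum.inr_injective this
      exact absurd (by rw [σ.sL_sL] at this; exact this.symm) hj
  subst this
  exact ⟨h2, fun f hf => h3 f (hf.trans ht.symm)⟩

end Simple

end RealStructure

namespace Marking

variable {V B L : Type} [Fintype B] [Fintype L] {Γ : TropCurve V B L} {σ : RealStructure Γ}
  (m : Marking σ)

lemma iota_inr (j : L) : m.iota (Sum.inr j) = m.rank j := by
  have : {k | ∃ l, Γ.Through (Sum.inr j : B ⊕ L) l ∧ m.rank l = k} = {m.rank j} := by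
    ext k
    constructor
    · rintro ⟨l, hl, rfl⟩
      obtain rfl : l = j := hl
      rfl
    · rintro rfl
      exact ⟨j, rfl, rfl⟩
  rw [iota, this, csInf_singleton]

lemma iota_sL (j : L) : m.iota (Sum.inr (σ.sL j)) = m.iota (Sum.inr j) := by
  rw [iota_inr, iota_inr]
  exact ((m.rank_eq_iff _ _).2 (Or.inr rfl)).symm

variable {m}

/-- The normalization fixes the values of `β` on all edges but the free ones. -/
lemma exists_normalized_iff (h : σ.Simple) (e : B ⊕ L) :
    (∃ c, m.Normalized e c) ↔ ¬ σ.Free e := by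
  constructor
  · rintro ⟨c, hc⟩ hfree
    have hCC : ¬ m.NormCC e := fun h' => h'.2.1 hfree.1
    have h01 : m.Norm01 (Γ.tail e) → ¬ (m.IsMin e ∨ m.IsMax e) := by
      intro hn _
      obtain ⟨j, hj, hjt⟩ := hfree.2
      obtain ⟨-, hf⟩ := h.eq_of_free hfree hj hjt
      refine hj (Sum.inr_injective (hn (h.sV_eq _) (Sum.inr j) hjt ?_))
      by_cases hle : m.iota (Sum.inr j) ≤ m.iota e
      · left
        intro f hft
        rcases hf f (hft.trans hjt) with rfl | rfl | rfl
        · exact hle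
        · exact le_rfl
        · rw [iota_sL]
      · right
        intro f hft
        rcases hf f (hft.trans hjt) with rfl | rfl | rfl
        · exact (not_le.1 hle).le
        · exact le_rfl
        · rw [iota_sL]
    cases hc with
    | plus h1 _ => exact hCC h1
    | minus h1 _ => exact hCC h1
    | zero h1 h2 => exact h01 h1 (Or.inl h2)
    | one h1 h2 => exact h01 h1 (Or.inr h2)
  · intro hfree
    by_cases hreal : σ.sE e = e
    · have hall : ∀ f, Γ.tail f = Γ.tail e → σ.sE f = f := by
        rintro (b | j) hft
        · exact congrArg Sum.inl (h.sB_eq b)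
        · by_contra hj
          exact hfree ⟨hreal, j, fun h' => hj (congrArg Sum.inr h'), hft⟩
      have h01 : m.Norm01 (Γ.tail e) := fun _ f hf _ => hall f hf
      suffices m.IsMin e ∨ m.IsMax e by
        rcases this with h' | h'
        · exact ⟨0, .zero e h01 h'⟩
        · exact ⟨1, .one e h01 h'⟩
      rcases h.vertex (Γ.tail e) with ⟨f, f', -, -, hf⟩ | ⟨r, j, hr, h1, h2, h3, -⟩
      · by_contra! hcon
        simp only [IsMin, IsMax, not_forall, not_le] at hcon
        obtain ⟨⟨a, ha, ha'⟩, ⟨b, hb, hb'⟩⟩ := hcon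
        rcases hf e rfl with rfl | rfl <;> rcases hf a ha with rfl | rfl <;>
          rcases hf b hb with rfl | rfl <;> omega
      · exact absurd (hall _ h3) fun h' => h2 (Sum.inr_injective h')
    · rcases e with b | j
      · exact absurd (congrArg Sum.inl (h.sB_eq b)) hreal
      have hj : σ.sL j ≠ j := fun h' => hreal (congrArg Sum.inr h')
      suffices m.NormCC (Sum.inr j) by
        by_cases hp : m.LeadsPlus (Sum.inr j)
        · exact ⟨_, .plus _ this hp⟩
        · exact ⟨_, .minus _ this hp⟩
      obtain ⟨r, hr, hrt, -, hf⟩ := h.at_nonreal hj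
      refine ⟨h.sV_eq _, hreal, ?_⟩
      by_cases hle : m.iota (Sum.inr j) ≤ m.iota r
      · left
        intro f hft
        rcases hf f hft with rfl | rfl | rfl
        · exact hle
        · exact le_rfl
        · rw [iota_sL]
      · right
        refine ⟨fun f hft => ?_, fun f hft hmin => ?_⟩
        · rcases hf f hft with rfl | rfl | rfl
          · exact (not_le.1 hle).le
          · exact le_rfl
          · rw [iota_sL]
        · have h1 := hmin r (hrt.trans hft.symm)
          rcases hf f hft with rfl | rfl | rfl
          · exact hr.1
          · exact absurd h1 hle
          · rw [iota_sL] at h1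
            exact absurd h1 hle

end Marking

namespace Splitting

variable {V B L V₀ B₀ L₀ : Type} [Fintype B] [Fintype L] [Fintype B₀] [Fintype L₀]
  {Γ : TropCurve V B L} {σ : RealStructure Γ} {Γ₀ : TropCurve V₀ B₀ L₀}

lemma pB_bijective (π : Splitting Γ σ Γ₀) (hB : ∀ b, σ.sB b = b) : Function.Bijective π.pB := by
  refine ⟨fun b c h => ?_, π.pB_surjective⟩
  rcases (π.pB_eq_iff b c).1 h with h | h
  · exact h.symm
  · rw [h, hB]

lemma pV_injective (π : Splitting Γ σ Γ₀) (hB : ∀ b, σ.sB b = b) : Function.Injective π.pV := by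
  intro v w h
  rcases (π.pV_eq_iff v w).1 h with h | h
  · exact h.symm
  · rw [h, RealStructure.sV_eq_self hB]

lemma le_iff (π : Splitting Γ σ Γ₀) (hB : ∀ b, σ.sB b = b) {u w : V} :
    Γ₀.Le (π.pV u) (π.pV w) ↔ Γ.Le u w := by
  constructor
  · intro h
    generalize hy : π.pV w = y at h
    induction h generalizing w with
    | refl => exact π.pV_injective hB hy ▸ Γ.le_refl _
    | tail h1 h2 ih =>
      obtain ⟨b₀, hb₀, hb₀'⟩ := h2
      obtain ⟨b, rfl⟩ := π.pB_surjective b₀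
      rw [π.head_comm, ← hy] at hb₀'
      obtain rfl := π.pV_injective hB hb₀'
      have h3 := π.tail_comm (Sum.inl b)
      exact (ih (h3.symm.trans hb₀)).trans (TropTree.tail_le_head b)
  · refine fun h => Relation.ReflTransGen.lift π.pV ?_ _ _ h
    rintro _ _ ⟨b, rfl, rfl⟩
    exact ⟨π.pB b, π.tail_comm (Sum.inl b), π.head_comm b⟩

/-- The orbits of the edges leaving a vertex correspond to the edges leaving its image. -/
lemma exists_orbits (π : Splitting Γ σ Γ₀) (hB : ∀ b, σ.sB b = b) {v : V}
    (hv : (Finset.univ.filter (fun e => Γ₀.tail e = π.pV v)).card = 2) :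
    ∃ e e', Γ.tail e = v ∧ Γ.tail e' = v ∧
      ∀ f, Γ.tail f = v → (f = e ∨ f = σ.sE e) ∨ (f = e' ∨ f = σ.sE e') := by
  have hlift : ∀ e₀, Γ₀.tail e₀ = π.pV v → ∃ e, Γ.tail e = v ∧ Sum.map π.pB π.pL e = e₀ := by
    intro e₀ he₀
    obtain ⟨e, rfl⟩ : ∃ e, Sum.map π.pB π.pL e = e₀ := by
      rcases e₀ with b₀ | l₀
      · obtain ⟨b, rfl⟩ := π.pB_surjective b₀
        exact ⟨Sum.inl b, rfl⟩
      · obtain ⟨l, rfl⟩ := π.pL_surjective l₀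
        exact ⟨Sum.inr l, rfl⟩
    rw [π.tail_comm] at he₀
    exact ⟨e, π.pV_injective hB he₀, rfl⟩
  have horbit : ∀ e f, Sum.map π.pB π.pL e = Sum.map π.pB π.pL f → f = e ∨ f = σ.sE e := by
    rintro (b | l) (b' | l') h
    · rcases (π.pB_eq_iff b b').1 (Sum.inl_injective h) with rfl | rfl
      · exact Or.inl rfl
      · exact Or.inr rfl
    · cases h
    · cases h
    · rcases (π.pL_eq_iff l l').1 (Sum.inr_injective h) with rfl | rfl
      · exact Or.inl rfl
      · exact Or.inr rfl
  obtain ⟨x, y, -, hxy⟩ := Finset.card_eq_two.1 hv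
  have hmem : ∀ z, Γ₀.tail z = π.pV v ↔ z = x ∨ z = y := by
    intro z
    have : z ∈ Finset.univ.filter (fun e => Γ₀.tail e = π.pV v) ↔ z ∈ ({x, y} : Finset _) := by
      rw [hxy]
    simpa using this
  obtain ⟨e, he, rfl⟩ := hlift x ((hmem x).2 (Or.inl rfl))
  obtain ⟨e', he', rfl⟩ := hlift y ((hmem y).2 (Or.inr rfl))
  refine ⟨e, e', he, he', fun f hf => ?_⟩
  have hf' : Γ₀.tail (Sum.map π.pB π.pL f) = π.pV v := by rw [π.tail_comm, hf]
  rcases (hmem _).1 hf' with h | h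
  · exact Or.inl (horbit _ _ h.symm)
  · exact Or.inr (horbit _ _ h.symm)

lemma simple (π : Splitting Γ σ Γ₀) [Finite V] {n₁ : LatN}
    (hn₁ : ∀ l, σ.sL l ≠ l → Γ.slope (Sum.inr l) = n₁) (hflat : Γ.NoFlat)
    (hcard : ∀ v, (Finset.univ.filter (fun e => Γ₀.tail e = v)).card = 2) : σ.Simple := by
  have hB := RealStructure.sB_eq_self hn₁ hflat
  have hslope : ∀ e, σ.sE e ≠ e → Γ.slope e = n₁ ∧ ∃ j, σ.sL j ≠ j ∧ e = Sum.inr j := by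
    rintro (b | j) he
    · exact absurd (congrArg Sum.inl (hB b)) he
    · have hj : σ.sL j ≠ j := fun h' => he (congrArg Sum.inr h')
      exact ⟨hn₁ j hj, j, hj, rfl⟩
  have hslope' : ∀ e f, (f = e ∨ f = σ.sE e) → Γ.slope f = Γ.slope e := by
    rintro e f (rfl | rfl)
    · rfl
    · exact σ.slope_comm e
  have hself : ∀ n, omega n n = 0 := fun n => by rw [omega]; ring
  have mixed : ∀ v e e', Γ.tail e = v → Γ.tail e' = v →
      (∀ f, Γ.tail f = v → (f = e ∨ f = σ.sE e) ∨ (f = e' ∨ f = σ.sE e')) →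
      σ.sE e = e → σ.sE e' ≠ e' →
      ∃ r j, σ.Free r ∧ Γ.tail r = v ∧ σ.sL j ≠ j ∧ Γ.tail (Sum.inr j) = v ∧
      omega (Γ.slope (Sum.inr j)) (Γ.slope r) ≠ 0 ∧
      ∀ f, Γ.tail f = v → f = r ∨ f = Sum.inr j ∨ f = Sum.inr (σ.sL j) := by
    intro v e e' he he' hf hr hr'
    obtain ⟨hs, j, hj, rfl⟩ := hslope e' hr'
    refine ⟨e, j, ⟨hr, j, hj, he'.trans he.symm⟩, he, hj, he', ?_, ?_⟩
    · intro h0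
      obtain ⟨f, f', hft, hft', h⟩ := hflat v
      refine h ?_
      have h0' : omega (Γ.slope e) (Γ.slope (Sum.inr j)) = 0 := by
        rw [omega] at h0 ⊢; linarith
      rcases hf f hft with h1 | h1 <;> rcases hf f' hft' with h2 | h2 <;>
        rw [hslope' _ _ h1, hslope' _ _ h2] <;> first | exact hself _ | assumption
    · intro f hft
      rcases hf f hft with (h1 | h1) | h1 | h1
      · exact Or.inl h1
      · exact Or.inl (h1.trans hr)
      · exact Or.inr (Or.inl h1)
      · exact Or.inr (Or.inr h1)
  refine ⟨hB, fun v => ?_⟩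
  obtain ⟨e, e', he, he', hf⟩ := π.exists_orbits hB (hcard (π.pV v))
  by_cases hr : σ.sE e = e <;> by_cases hr' : σ.sE e' = e'
  · left
    refine ⟨e, e', hr, hr', fun f hft => ?_⟩
    simpa only [hr, hr', or_self] using hf f hft
  · exact Or.inr (mixed v e e' he he' hf hr hr')
  · exact Or.inr (mixed v e' e he' he (fun f hft => (hf f hft).symm) hr' hr)
  · exfalso
    obtain ⟨f, f', hft, hft', h⟩ := hflat v
    have hn : ∀ f, Γ.tail f = v → Γ.slope f = n₁ := by
      intro f hft
      rcases hf f hft with h1 | h1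
      · rw [hslope' _ _ h1, (hslope e hr).1]
      · rw [hslope' _ _ h1, (hslope e' hr').1]
    exact h (by rw [hn f hft, hn f' hft', hself])

lemma momentMap_comm (π : Splitting Γ σ Γ₀) (hB : ∀ b, σ.sB b = b)
    (x : Fin 2 → ℂ) (a : B₀ → ℂ) (j : L) :
    Γ₀.momentMap (x, a) (π.pL j) =
      (if σ.sL j = j then 1 else 2) * Γ.momentMap (x, a ∘ π.pB) j := by
  rw [TropCurve.momentMap_apply, TropCurve.momentMap_apply]
  have hsum : ∑ b ∈ Finset.univ.filter (fun b => Γ₀.Le (Γ₀.head b) (Γ₀.tail (Sum.inr (π.pL j)))),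
        a b • toC (Γ₀.slope (Sum.inl b)) =
      ∑ b ∈ Finset.univ.filter (fun b => Γ.Le (Γ.head b) (Γ.tail (Sum.inr j))),
        (a ∘ π.pB) b • toC (Γ.slope (Sum.inl b)) := by
    symm
    have ht : Γ₀.tail (Sum.inr (π.pL j)) = π.pV (Γ.tail (Sum.inr j)) := π.tail_comm (Sum.inr j)
    refine Finset.sum_nbij π.pB ?_ (π.pB_bijective hB).1.injOn ?_ ?_
    · intro b hb
      simp only [Finset.mem_filter, Finset.mem_univ, true_and] at hb ⊢
      rw [ht, π.head_comm, π.le_iff hB]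
      exact hb
    · intro b₀ hb₀
      obtain ⟨b, rfl⟩ := π.pB_surjective b₀
      simp only [Finset.coe_filter, Finset.mem_univ, true_and, Set.mem_ofPred_eq] at hb₀
      rw [ht, π.head_comm, π.le_iff hB] at hb₀
      exact ⟨b, by simpa using hb₀, rfl⟩
    · intro b _
      have := π.slope_real (Sum.inl b) (congrArg Sum.inl (hB b))
      rw [Sum.map_inl] at this
      rw [this]
      rfl
  rw [hsum]
  by_cases hj : σ.sL j = j
  · have := π.slope_real (Sum.inr j) (congrArg Sum.inr hj)
    rw [Sum.map_inr] at this
    rw [this, if_pos hj, one_mul]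
  · have := π.slope_complex (Sum.inr j) fun h => hj (Sum.inr_injective h)
    rw [Sum.map_inr] at this
    rw [this, if_neg hj]
    simp only [omegaC_apply, two_nsmul, Pi.add_apply, Int.cast_add]
    ring

lemma momentMap_injective (π : Splitting Γ σ Γ₀) (hB : ∀ b, σ.sB b = b)
    (h : Function.Injective Γ₀.momentMap) :
    Function.Injective Γ.momentMap := by
  rw [← LinearMap.ker_eq_bot, LinearMap.ker_eq_bot'] at h ⊢
  rintro ⟨x, a⟩ h0
  let ε := Equiv.ofBijective π.pB (π.pB_bijective hB)
  have ha : (a ∘ ε.symm) ∘ π.pB = a := by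
    funext b
    exact congrArg a (ε.symm_apply_apply b)
  have := h (x, a ∘ ε.symm) ?_
  · obtain ⟨h1, h2⟩ := Prod.mk.inj this
    rw [← ha, h2, h1]
    rfl
  · funext l₀
    obtain ⟨l, rfl⟩ := π.pL_surjective l₀
    rw [π.momentMap_comm hB, ha, h0]
    simp

lemma exists_momentMap_eq (π : Splitting Γ σ Γ₀) (hB : ∀ b, σ.sB b = b)
    (h : Function.Surjective Γ₀.momentMap)
    (R : L → ℂ) (hR : ∀ j, R (σ.sL j) = R j) : ∃ y, Γ.momentMap y = R := by
  choose s hs using π.pL_surjective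
  obtain ⟨⟨x, a⟩, hy⟩ := h fun l₀ => (if σ.sL (s l₀) = s l₀ then 1 else 2) * R (s l₀)
  refine ⟨(x, a ∘ π.pB), ?_⟩
  have key : ∀ l₀, Γ.momentMap (x, a ∘ π.pB) (s l₀) = R (s l₀) := by
    intro l₀
    have h1 := congrFun hy l₀
    nth_rewrite 1 [← hs l₀] at h1
    rw [π.momentMap_comm hB] at h1
    refine mul_left_cancel₀ ?_ h1
    split_ifs <;> norm_num
  funext j
  rcases (π.pL_eq_iff (s (π.pL j)) j).1 (hs _) with h1 | h1
  · rw [h1, key]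
  · rw [h1, hR, ← key, TropCurve.momentMap_apply, TropCurve.momentMap_apply]
    have h2 : Γ.tail (Sum.inr (σ.sL (s (π.pL j)))) = Γ.tail (Sum.inr (s (π.pL j))) :=
      RealStructure.tail_sE hB (Sum.inr (s (π.pL j)))
    have h3 : Γ.slope (Sum.inr (σ.sL (s (π.pL j)))) = Γ.slope (Sum.inr (s (π.pL j))) :=
      σ.slope_comm (Sum.inr (s (π.pL j)))
    rw [h2, h3]

end Splitting

namespace TropCurve

variable {V B L : Type} [Fintype B] [Fintype L] (Γ : TropCurve V B L)

/-- The logarithmic differential of `φ_b`. -/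
def edgeTerm (β δ : B ⊕ L → ℂ) (b : B) (i : Fin 2) : ℂ :=
  ∑ l ∈ Finset.univ.filter (fun l => Γ.Above (Γ.tail (Sum.inl b)) l ∧ ¬ Γ.Above (Γ.head b) l),
    (Γ.slope (Sum.inr l) i : ℂ) * ((δ (Γ.dir (Γ.tail (Sum.inl b)) l) - δ (Sum.inl b)) /
      (β (Γ.dir (Γ.tail (Sum.inl b)) l) - β (Sum.inl b)))

/-- The logarithmic differential of `φ_j`. -/
def endTerm (β δ : B ⊕ L → ℂ) (j : L) : ℂ :=
  ∑ l ∈ Finset.univ.filter (fun l => Γ.Above (Γ.tail (Sum.inr j)) l),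
    (omega (Γ.slope (Sum.inr j)) (Γ.slope (Sum.inr l)) : ℂ) *
      ((δ (Sum.inr j) - δ (Γ.dir (Γ.tail (Sum.inr j)) l)) /
        (β (Sum.inr j) - β (Γ.dir (Γ.tail (Sum.inr j)) l)))

variable {Γ}

lemma logDiff_edge (c d : Params V B L ℂ) (b : B) (i : Fin 2) :
    (Γ.logDiff c d).1 b i = Γ.edgeTerm c.2.2 d.2.2 b i +
      (d.1 (Γ.tail (Sum.inl b)) i / c.1 (Γ.tail (Sum.inl b)) i -
        d.1 (Γ.head b) i / c.1 (Γ.head b) i) +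
      (Γ.slope (Sum.inl b) i : ℂ) * (d.2.1 b / c.2.1 b) := rfl

lemma logDiff_end (c d : Params V B L ℂ) (j : L) :
    (Γ.logDiff c d).2 j = omegaC (Γ.slope (Sum.inr j))
      (fun i => d.1 (Γ.tail (Sum.inr j)) i / c.1 (Γ.tail (Sum.inr j)) i) +
      Γ.endTerm c.2.2 d.2.2 j := by
  rw [logDiff, omegaC_apply, endTerm]
  push_cast
  ring

end TropCurve

namespace RealStructure

variable {V B L : Type} [Fintype B] [Fintype L] {Γ : TropCurve V B L} {σ : RealStructure Γ}

namespace Simple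

lemma endTerm_eq [Finite V] (h : σ.Simple) {r : B ⊕ L} (hr : σ.Free r) {j : L}
    (hj : σ.sL j ≠ j) (ht : Γ.tail (Sum.inr j) = Γ.tail r) {β δ : B ⊕ L → ℂ}
    (hδ : ∀ e, ¬ σ.Free e → δ e = 0) :
    Γ.endTerm β δ j = -(omega (Γ.slope (Sum.inr j)) (Γ.slope r) * (δ r / (β (Sum.inr j) - β r))) := by
  have hδj : δ (Sum.inr j) = 0 := hδ _ fun hf => hj (Sum.inr_injective hf.1)
  have hδj' : δ (Sum.inr (σ.sL j)) = 0 := by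
    refine hδ _ fun hf => hj ?_
    have := Sum.inr_injective hf.1
    rw [σ.sL_sL] at this
    exact this.symm
  rw [TropCurve.endTerm, ← Finset.sum_subset
    (s₁ := Finset.univ.filter (fun l => Γ.Through r l))]
  · rw [Γ.slope_eq_sum r, omega_sum_right]
    push_cast
    rw [Finset.sum_mul, ← Finset.sum_neg_distrib]
    refine Finset.sum_congr rfl fun l hl => ?_
    have hl : Γ.Through r l := by simpa using hl
    rw [ht, hl.dir_eq, hδj]
    ring
  · intro l hl
    simp only [Finset.mem_filter, Finset.mem_univ, true_and] at hl ⊢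
    rw [ht]
    exact hl.above
  · intro l hl hl'
    simp only [Finset.mem_filter, Finset.mem_univ, true_and] at hl hl'
    have h1 := hl.tail_dir
    rcases (h.eq_of_free hr hj ht).2 _ (h1.trans ht) with h2 | h2 | h2
    · refine absurd ?_ hl'
      rw [ht] at hl h2
      exact hl.through_iff.2 h2
    · rw [h2]
      simp
    · rw [h2, hδj, hδj']
      simp

lemma pair_ne (h : σ.Simple) {c : Params V B L ℂ} (hc : Γ.Regular c) {r : B ⊕ L}
    (hr : σ.Free r) {j : L} (hj : σ.sL j ≠ j) (ht : Γ.tail (Sum.inr j) = Γ.tail r) :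
    (omega (Γ.slope (Sum.inr j)) (Γ.slope r) : ℂ) *
      (1 / (c.2.2 (Sum.inr (σ.sL j)) - c.2.2 r) - 1 / (c.2.2 (Sum.inr j) - c.2.2 r)) ≠ 0 := by
  have hreal : ∀ k, σ.sL k ≠ k → Sum.inr k ≠ r := by
    rintro k hk rfl
    exact hk (Sum.inr_injective hr.1)
  have hj' : σ.sL (σ.sL j) ≠ σ.sL j := by rw [σ.sL_sL]; exact hj.symm
  have h1 : c.2.2 (Sum.inr j) - c.2.2 r ≠ 0 :=
    sub_ne_zero.2 (hc.beta_ne _ _ (hreal j hj) ht)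
  have h2 : c.2.2 (Sum.inr (σ.sL j)) - c.2.2 r ≠ 0 :=
    sub_ne_zero.2 (hc.beta_ne _ _ (hreal _ hj') ((h.tail_sL j).trans ht))
  have h3 : c.2.2 (Sum.inr j) - c.2.2 (Sum.inr (σ.sL j)) ≠ 0 :=
    sub_ne_zero.2 (hc.beta_ne _ _ (fun h' => hj (Sum.inr_injective h').symm) (h.tail_sL j).symm)
  refine mul_ne_zero (by exact_mod_cast (h.eq_of_free hr hj ht).1) ?_
  rw [div_sub_div _ _ h2 h1]
  refine div_ne_zero ?_ (mul_ne_zero h2 h1)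
  convert h3 using 1
  ring

lemma slope_sL (j : L) : Γ.slope (Sum.inr (σ.sL j)) = Γ.slope (Sum.inr j) :=
  σ.slope_comm (Sum.inr j)

lemma endTerm_sub [Finite V] (h : σ.Simple) {r : B ⊕ L} (hr : σ.Free r) {j : L}
    (hj : σ.sL j ≠ j) (ht : Γ.tail (Sum.inr j) = Γ.tail r) {β δ : B ⊕ L → ℂ}
    (hδ : ∀ e, ¬ σ.Free e → δ e = 0) :
    Γ.endTerm β δ j - Γ.endTerm β δ (σ.sL j) =
      omega (Γ.slope (Sum.inr j)) (Γ.slope r) *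
        (1 / (β (Sum.inr (σ.sL j)) - β r) - 1 / (β (Sum.inr j) - β r)) * δ r := by
  have hj' : σ.sL (σ.sL j) ≠ σ.sL j := by rw [σ.sL_sL]; exact hj.symm
  rw [h.endTerm_eq hr hj ht hδ, h.endTerm_eq hr hj' ((h.tail_sL j).trans ht) hδ, slope_sL]
  ring

lemma eq_zero_of_logDiff_eq_zero [Finite V] (h : σ.Simple)
    (hinj : Function.Injective Γ.momentMap) {c d : Params V B L ℂ} (hc : Γ.Regular c)
    (hd : ∀ e, ¬ σ.Free e → d.2.2 e = 0) (h0 : Γ.logDiff c d = 0) : d = 0 := by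
  have hedge : ∀ b i, (Γ.logDiff c d).1 b i = 0 := fun b i => by rw [h0]; rfl
  have hend : ∀ j, (Γ.logDiff c d).2 j = 0 := fun j => by rw [h0]; rfl
  have hδ : d.2.2 = 0 := by
    funext r
    by_cases hr : σ.Free r
    · obtain ⟨j, hj, ht⟩ := hr.2
      have h1 := hend j
      have h2 := hend (σ.sL j)
      rw [TropCurve.logDiff_end] at h1 h2
      rw [slope_sL, h.tail_sL] at h2
      have h3 := h.endTerm_sub hr hj ht hd (β := c.2.2)
      have h4 : Γ.endTerm c.2.2 d.2.2 j - Γ.endTerm c.2.2 d.2.2 (σ.sL j) = 0 := by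
        linear_combination h1 - h2
      rw [h4] at h3
      exact (mul_eq_zero.1 h3.symm).resolve_left (h.pair_ne hc hr hj ht)
    · exact hd r hr
  have hE : ∀ b i, Γ.edgeTerm c.2.2 d.2.2 b i = 0 := fun b i => by
    simp [TropCurve.edgeTerm, hδ]
  have hG : ∀ j, Γ.endTerm c.2.2 d.2.2 j = 0 := fun j => by
    simp [TropCurve.endTerm, hδ]
  have hx : ∀ w, (fun i => d.1 w i / c.1 w i) = (fun i => d.1 Γ.root i / c.1 Γ.root i) +
      ∑ b ∈ Finset.univ.filter (fun b => Γ.Le (Γ.head b) w),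
        (d.2.1 b / c.2.1 b) • toC (Γ.slope (Sum.inl b)) := by
    intro w
    induction w using Γ.root_induction with
    | h0 => rw [Γ.sum_ancestors_root, add_zero]
    | h1 b ih =>
      rw [Γ.sum_ancestors_head, add_left_comm, ← ih]
      funext i
      have := hedge b i
      rw [TropCurve.logDiff_edge, hE] at this
      simp only [Pi.add_apply, Pi.smul_apply, smul_eq_mul, toC]
      linear_combination -this
  have hzero := hinj (a₁ := (fun i => d.1 Γ.root i / c.1 Γ.root i, fun b => d.2.1 b / c.2.1 b))
    (a₂ := 0) (by
      rw [map_zero]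
      funext j
      have := hend j
      rw [TropCurve.logDiff_end, hG, add_zero, hx] at this
      rw [TropCurve.momentMap_apply, this]
      rfl)
  obtain ⟨h1, h2⟩ := Prod.mk.inj hzero
  have ha : d.2.1 = 0 := by
    funext b
    exact (div_eq_zero_iff.1 (congrFun h2 b)).resolve_right (hc.alpha_ne b)
  refine Prod.ext ?_ (Prod.ext ha hδ)
  funext w i
  have := congrFun (hx w) i
  rw [h1] at this
  simp only [ha] at this
  refine (div_eq_zero_iff.1 (this.trans ?_)).resolve_right (hc.chi_ne w i)
  simp

lemma exists_logDiff_eq [Finite V] (h : σ.Simple)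
    (hsurj : ∀ R : L → ℂ, (∀ j, R (σ.sL j) = R j) → ∃ y, Γ.momentMap y = R)
    {c : Params V B L ℂ} (hc : Γ.Regular c) (R : Target B L ℂ) :
    ∃ d : Params V B L ℂ, (∀ e, ¬ σ.Free e → d.2.2 e = 0) ∧ Γ.logDiff c d = R := by
  let K : B ⊕ L → L → ℂ := fun r j => omega (Γ.slope (Sum.inr j)) (Γ.slope r) *
    (1 / (c.2.2 (Sum.inr (σ.sL j)) - c.2.2 r) - 1 / (c.2.2 (Sum.inr j) - c.2.2 r))
  obtain ⟨δ, hδ0, hδ⟩ : ∃ δ : B ⊕ L → ℂ, (∀ e, ¬ σ.Free e → δ e = 0) ∧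
      ∀ r, σ.Free r → ∃ j, σ.sL j ≠ j ∧ Γ.tail (Sum.inr j) = Γ.tail r ∧
        K r j * δ r = R.2 j - R.2 (σ.sL j) := by
    refine ⟨fun r => if hr : σ.Free r then
      (R.2 hr.2.choose - R.2 (σ.sL hr.2.choose)) / K r hr.2.choose else 0,
      fun e he => dif_neg he, fun r hr => ⟨hr.2.choose, hr.2.choose_spec.1, hr.2.choose_spec.2, ?_⟩⟩
    beta_reduce
    rw [dif_pos hr]
    exact mul_div_cancel₀ _ (h.pair_ne hc hr hr.2.choose_spec.1 hr.2.choose_spec.2)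
  have hpair : ∀ k, Γ.endTerm c.2.2 δ k - Γ.endTerm c.2.2 δ (σ.sL k) = R.2 k - R.2 (σ.sL k) := by
    intro k
    by_cases hk : σ.sL k = k
    · rw [hk, sub_self, sub_self]
    · obtain ⟨r, hr, hrt, -⟩ := h.at_nonreal hk
      obtain ⟨j, hj, ht, hjr⟩ := hδ r hr
      have h1 := (h.endTerm_sub hr hj ht hδ0 (β := c.2.2)).trans hjr
      rcases (h.eq_of_free hr hj ht).2 (Sum.inr k) hrt.symm with h2 | h2 | h2
      · have := hr.1
        rw [← h2] at this
        exact absurd (Sum.inr_injective this) hk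
      · rw [Sum.inr_injective h2]
        exact h1
      · rw [Sum.inr_injective h2, σ.sL_sL]
        linear_combination -h1
  let ρ : B → Fin 2 → ℂ := fun b i => Γ.edgeTerm c.2.2 δ b i - R.1 b i
  let S : V → Fin 2 → ℂ := fun w =>
    ∑ b ∈ Finset.univ.filter (fun b => Γ.Le (Γ.head b) w), ρ b
  obtain ⟨⟨x, a⟩, hxa⟩ := hsurj (fun j => R.2 j - Γ.endTerm c.2.2 δ j -
      omegaC (Γ.slope (Sum.inr j)) (S (Γ.tail (Sum.inr j)))) fun j => by
    rw [slope_sL, h.tail_sL]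
    linear_combination hpair j
  let X : V → Fin 2 → ℂ := fun w =>
    (x + ∑ b ∈ Finset.univ.filter (fun b => Γ.Le (Γ.head b) w),
      a b • toC (Γ.slope (Sum.inl b))) + S w
  have hX : ∀ b, X (Γ.head b) = X (Γ.tail (Sum.inl b)) + a b • toC (Γ.slope (Sum.inl b)) +
      ρ b := by
    intro b
    simp only [X, S]
    rw [Γ.sum_ancestors_head, Γ.sum_ancestors_head]
    abel
  refine ⟨(fun w i => X w i * c.1 w i, fun b => a b * c.2.1 b, δ), hδ0, Prod.ext ?_ ?_⟩
  · funext b i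
    rw [TropCurve.logDiff_edge]
    simp only [mul_div_cancel_right₀ _ (hc.chi_ne _ _), mul_div_cancel_right₀ _ (hc.alpha_ne _)]
    rw [hX]
    simp only [Pi.add_apply, Pi.smul_apply, smul_eq_mul, toC, ρ]
    ring
  · funext j
    rw [TropCurve.logDiff_end]
    simp only [mul_div_cancel_right₀ _ (hc.chi_ne _ _)]
    have := congrFun hxa j
    rw [TropCurve.momentMap_apply] at this
    change omegaC _ (X _) + _ = _
    simp only [X]
    rw [map_add, this]
    ring

end Simple

end RealStructure

section Hensel

open PowerSeries

/-- Hensel's lemma for maps `F` between products of copies of `ℂ[[t]]`, with a differential `D` mod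
`t` which is bijective on the families that vanish on a set `W` of coordinates. -/
lemma existsUnique_power_series_solution {ι κ : Type*}
    (F : (ι → ℂ⟦X⟧) → κ → ℂ⟦X⟧) (D : (ι → ℂ) → κ → ℂ) (W : Set ι) (p₀ : ι → ℂ⟦X⟧)
    (hF : ∀ n, 0 < n → ∀ p q : ι → ℂ⟦X⟧, (∀ i, constantCoeff (p i) = constantCoeff (p₀ i)) →
      ∃ g : κ → ℂ⟦X⟧, (F (fun i => p i + X ^ n * q i) = fun k => F p k + X ^ n * g k) ∧
        ∀ k, constantCoeff (g k) = D (fun i => constantCoeff (q i)) k)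
    (hD : ∀ d, (∀ i ∈ W, d i = 0) → D d = 0 → d = 0)
    (hD' : ∀ r, ∃ d, (∀ i ∈ W, d i = 0) ∧ D d = r)
    (τ : κ → ℂ⟦X⟧) (hτ : ∀ k, constantCoeff (F p₀ k) = constantCoeff (τ k)) :
    ∃! p : ι → ℂ⟦X⟧, (∀ i, constantCoeff (p i) = constantCoeff (p₀ i)) ∧
      (∀ i ∈ W, p i = p₀ i) ∧ F p = τ := by
  have hzero : ∀ f : ℂ⟦X⟧, (∀ n : ℕ, X ^ (n + 1) ∣ f) → f = 0 := fun f hf => by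
    ext n
    rw [X_pow_dvd_iff.1 (hf n) n n.lt_succ_self, map_zero]
  have huniq : ∀ p p' : ι → ℂ⟦X⟧, (∀ i, constantCoeff (p i) = constantCoeff (p₀ i)) →
      (∀ i, constantCoeff (p' i) = constantCoeff (p₀ i)) → (∀ i ∈ W, p' i = p i) →
      F p' = F p → p' = p := by
    intro p p' hp hp' hW hFp
    have key : ∀ n i, X ^ (n + 1) ∣ p' i - p i := by
      intro n
      induction n with
      | zero =>
        intro i
        rw [zero_add, pow_one, X_dvd_iff, map_sub, hp, hp', sub_self]
      | succ n ih =>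
        choose q hq using ih
        have hpq : (fun i => p i + X ^ (n + 1) * q i) = p' := by
          funext i
          rw [← hq, add_sub_cancel]
        obtain ⟨g, hg, hg0⟩ := hF (n + 1) n.succ_pos p q hp
        rw [hpq, hFp] at hg
        have hX : (X : ℂ⟦X⟧) ^ (n + 1) ≠ 0 := pow_ne_zero _ X_ne_zero
        have hg' : ∀ k, g k = 0 := fun k =>
          (mul_eq_zero.1 (left_eq_add.1 (congrFun hg k))).resolve_left hX
        have h0 := hD (fun i => constantCoeff (q i)) (fun i hi => by
          have : X ^ (n + 1) * q i = 0 := by rw [← hq, hW i hi, sub_self]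
          rw [(mul_eq_zero.1 this).resolve_left hX, map_zero]) (by
          funext k
          rw [← hg0, hg', map_zero]
          rfl)
        intro i
        rw [hq, pow_succ]
        exact mul_dvd_mul_left _ (X_dvd_iff.2 (congrFun h0 i))
    funext i
    exact sub_eq_zero.1 (hzero _ fun n => key n i)
  choose δ hδW hδ using hD'
  let s : ℕ → ι → ℂ⟦X⟧ := fun n => Nat.rec p₀
    (fun n p i => p i + X ^ (n + 1) * C (δ (fun k => coeff (n + 1) (τ k - F p k)) i)) n
  have hs : ∀ n i, s (n + 1) i = s n i +
      X ^ (n + 1) * C (δ (fun k => coeff (n + 1) (τ k - F (s n) k)) i) := fun n i => rfl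
  have hs0 : ∀ n i, constantCoeff (s n i) = constantCoeff (p₀ i) := by
    intro n i
    induction n with
    | zero => rfl
    | succ n ih => rw [hs, map_add, ih]; simp
  have hsτ : ∀ n k, X ^ (n + 1) ∣ τ k - F (s n) k := by
    intro n
    induction n with
    | zero =>
      intro k
      rw [zero_add, pow_one, X_dvd_iff, map_sub]
      exact sub_eq_zero.2 (hτ k).symm
    | succ n ih =>
      intro k
      obtain ⟨g, hg, hg0⟩ := hF (n + 1) n.succ_pos (s n)
        (fun i => C (δ (fun k => coeff (n + 1) (τ k - F (s n) k)) i)) (hs0 n)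
      have h1 : F (s (n + 1)) = fun k => F (s n) k + X ^ (n + 1) * g k := hg
      obtain ⟨u, hu⟩ := ih k
      have h2 : constantCoeff u = constantCoeff (g k) := by
        rw [hg0]
        simp only [constantCoeff_C]
        change _ = D (δ _) k
        rw [hδ, hu]
        have := coeff_X_pow_mul u (n + 1) 0
        simpa using this.symm
      obtain ⟨v, hv⟩ := X_dvd_iff.2 (show constantCoeff (u - g k) = 0 by rw [map_sub, h2, sub_self])
      refine ⟨v, ?_⟩
      rw [h1]
      linear_combination hu + X ^ (n + 1) * hv
  have hcoeff : ∀ i m n, m ≤ n → coeff m (s n i) = coeff m (s m i) := by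
    intro i m n hmn
    induction n, hmn using Nat.le_induction with
    | base => rfl
    | succ n hmn ih =>
      rw [hs, map_add, ih, coeff_X_pow_mul', if_neg (by omega), add_zero]
  let p : ι → ℂ⟦X⟧ := fun i => PowerSeries.mk fun m => coeff m (s m i)
  have hp : ∀ n i, X ^ (n + 1) ∣ p i - s n i := by
    intro n i
    rw [X_pow_dvd_iff]
    intro m hm
    rw [map_sub, coeff_mk, hcoeff i m n (by omega), sub_self]
  have hp0 : ∀ i, constantCoeff (p i) = constantCoeff (p₀ i) := by
    intro i
    have := X_dvd_iff.1 (by simpa using hp 0 i)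
    rw [map_sub, hs0] at this
    exact sub_eq_zero.1 this
  have hpW : ∀ i ∈ W, p i = p₀ i := by
    intro i hi
    have : ∀ n, s n i = p₀ i := by
      intro n
      induction n with
      | zero => rfl
      | succ n ih => rw [hs, ih, hδW _ i hi]; simp
    ext m
    rw [coeff_mk, this]
  have hpτ : F p = τ := by
    funext k
    refine sub_eq_zero.1 (hzero _ fun n => ?_)
    choose q hq using hp n
    obtain ⟨g, hg, -⟩ := hF (n + 1) n.succ_pos (s n) q (hs0 n)
    have h1 : F p = fun k => F (s n) k + X ^ (n + 1) * g k := by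
      rw [← hg]
      congr 1
      funext i
      rw [← hq, add_sub_cancel]
    have h2 : F p k - τ k = X ^ (n + 1) * g k - (τ k - F (s n) k) := by
      rw [h1]
      ring
    rw [h2]
    exact dvd_sub (dvd_mul_right _ _) (hsτ n k)
  refine ⟨p, ⟨hp0, hpW, hpτ⟩, ?_⟩
  rintro p' ⟨h1, h2, h3⟩
  exact huniq p p' hp0 h1 (fun i hi => (h2 i hi).trans (hpW i hi).symm) (h3.trans hpτ.symm)

end Hensel

/-- Coefficientwise complex conjugation on `ℂ((t))`, as a ring homomorphism. -/
def conjLHom : LaurentSeries ℂ →+* LaurentSeries ℂ where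
  toFun := conjL
  map_one' := HahnSeries.map_one (starRingEnd ℂ).toMonoidWithZeroHom
  map_mul' _ _ := HahnSeries.map_mul ((starRingEnd ℂ : ℂ →+* ℂ) : ℂ →ₙ+* ℂ)
  map_zero' := HahnSeries.map_zero ((starRingEnd ℂ : ℂ →+* ℂ) : ZeroHom ℂ ℂ)
  map_add' _ _ := HahnSeries.map_add ((starRingEnd ℂ : ℂ →+* ℂ) : ℂ →+ ℂ)

lemma conjLHom_apply (f : LaurentSeries ℂ) : conjLHom f = conjL f := rfl

lemma conjL_coeff (f : LaurentSeries ℂ) (n : ℤ) :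
    (conjL f).coeff n = starRingEnd ℂ (f.coeff n) := rfl

lemma conjL_conjL (f : LaurentSeries ℂ) : conjL (conjL f) = f := by
  ext n
  rw [conjL_coeff, conjL_coeff, Complex.conj_conj]

lemma conjP_conjP (f : ℂ⟦X⟧) : conjP (conjP f) = f := by
  ext n
  simp [conjP]

lemma constantCoeff_conjP (f : ℂ⟦X⟧) :
    PowerSeries.constantCoeff (conjP f) = starRingEnd ℂ (PowerSeries.constantCoeff f) := by
  rw [← PowerSeries.coeff_zero_eq_constantCoeff_apply, conjP, PowerSeries.coeff_map,
    PowerSeries.coeff_zero_eq_constantCoeff_apply]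

lemma conjP_C (z : ℂ) : conjP (PowerSeries.C z) = PowerSeries.C (starRingEnd ℂ z) := by
  rw [conjP, PowerSeries.map_C]

lemma toL_coeff (f : ℂ⟦X⟧) (n : ℤ) :
    (toL f).coeff n = if n < 0 then 0 else PowerSeries.coeff n.natAbs f :=
  PowerSeries.coeff_coe f n

lemma conjL_toL (f : ℂ⟦X⟧) : conjL (toL f) = toL (conjP f) := by
  ext n
  rw [conjL_coeff, toL_coeff, toL_coeff, conjP, PowerSeries.coeff_map]
  split_ifs
  · exact map_zero _
  · rfl

lemma conjL_tt : conjL tt = tt := by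
  have h := conjL_toL PowerSeries.X
  have hX : toL PowerSeries.X = tt := HahnSeries.ofPowerSeries_X
  rwa [conjP, PowerSeries.map_X, hX] at h

lemma conjL_order (f : LaurentSeries ℂ) : (conjL f).order = f.order := by
  have key : ∀ g : LaurentSeries ℂ, g ≠ 0 → (conjL g).order ≤ g.order := fun g hg => by
    refine HahnSeries.order_le_of_coeff_ne_zero ?_
    rw [conjL_coeff]
    exact (map_ne_zero _).2 fun h => hg (HahnSeries.coeff_order_eq_zero.1 h)
  by_cases hf : f = 0
  · rw [hf, ← conjLHom_apply, map_zero]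
  · have hf' : conjL f ≠ 0 := (map_ne_zero conjLHom).2 hf
    refine le_antisymm (key f hf) ?_
    simpa only [conjL_conjL] using key _ hf'

lemma normMoment_conjL (f : LaurentSeries ℂ) : normMoment (conjL f) = conjL (normMoment f) := by
  rw [normMoment, normMoment, conjL_order, ← conjLHom_apply, ← conjLHom_apply, map_mul]
  congr 1
  ext n
  rw [conjLHom_apply, conjL_coeff, HahnSeries.coeff_single]
  split_ifs
  · exact (map_one _).symm
  · exact (map_zero _).symm

namespace RealStructure

variable {V B L : Type} [Fintype B] [Fintype L] {Γ : TropCurve V B L} (σ : RealStructure Γ)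

lemma sE_sE (e : B ⊕ L) : σ.sE (σ.sE e) = e := by
  rcases e with b | l
  · exact congrArg Sum.inl (σ.sB_sB b)
  · exact congrArg Sum.inr (σ.sL_sL l)

lemma le_iff {u w : V} : Γ.Le (σ.sV u) (σ.sV w) ↔ Γ.Le u w :=
  ⟨fun h => by simpa only [σ.sV_sV] using σ.le_map h, σ.le_map⟩

/-- The action of `σ` and of a conjugation `κ` on families of parameters. -/
def conjParams {R : Type} (κ : R → R) (p : Params V B L R) : Params V B L R :=
  (fun v i => κ (p.1 (σ.sV v) i), fun b => κ (p.2.1 (σ.sB b)), fun e => κ (p.2.2 (σ.sE e)))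

/-- The action of `σ` and of a conjugation `κ` on the target of `Θ`. -/
def conjTarget {R : Type} (κ : R → R) (r : Target B L R) : Target B L R :=
  (fun b i => κ (r.1 (σ.sB b) i), fun l => κ (r.2 (σ.sL l)))

lemma conjParams_beta_inr {R : Type} (κ : R → R) (p : Params V B L R) (l : L) :
    (σ.conjParams κ p).2.2 (Sum.inr l) = κ (p.2.2 (Sum.inr (σ.sL l))) := rfl

variable (p : Params V B L ℂ⟦X⟧)

lemma tail_inl (b : B) : Γ.tail (Sum.inl (σ.sB b)) = σ.sV (Γ.tail (Sum.inl b)) :=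
  σ.tail_comm (Sum.inl b)

lemma tail_inr (l : L) : Γ.tail (Sum.inr (σ.sL l)) = σ.sV (Γ.tail (Sum.inr l)) :=
  σ.tail_comm (Sum.inr l)

lemma above_iff {w : V} {l : L} : Γ.Above (σ.sV w) (σ.sL l) ↔ Γ.Above w l := by
  rw [TropTree.Above, σ.tail_inr, σ.le_iff, TropTree.Above]

lemma scale_conj (w : V) :
    Γ.scale (σ.conjParams conjP p) w = conjL (Γ.scale p (σ.sV w)) := by
  rw [← conjLHom_apply, TropCurve.scale, TropCurve.scale, map_prod]
  refine Finset.prod_nbij' σ.sB σ.sB ?_ ?_ (fun b _ => σ.sB_sB b) (fun b _ => σ.sB_sB b) ?_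
  · intro b hb
    simpa [σ.head_comm, σ.le_iff] using hb
  · intro b hb
    have h : Γ.Le (Γ.head b) (σ.sV w) := by simpa using hb
    have := σ.le_map h
    rw [σ.sV_sV, ← σ.head_comm] at this
    simpa using this
  · intro b _
    rw [map_mul, map_pow, conjLHom_apply, conjLHom_apply, conjL_tt, conjL_toL, σ.len_comm]
    rfl

lemma center_conj (w : V) :
    Γ.center (σ.conjParams conjP p) w = conjL (Γ.center p (σ.sV w)) := by
  rw [← conjLHom_apply, TropCurve.center, TropCurve.center, map_sum]
  refine Finset.sum_nbij' σ.sB σ.sB ?_ ?_ (fun b _ => σ.sB_sB b) (fun b _ => σ.sB_sB b) ?_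
  · intro b hb
    simpa [σ.head_comm, σ.le_iff] using hb
  · intro b hb
    have h : Γ.Le (Γ.head b) (σ.sV w) := by simpa using hb
    have := σ.le_map h
    rw [σ.sV_sV, ← σ.head_comm] at this
    simpa using this
  · intro b _
    rw [map_mul, conjLHom_apply, conjLHom_apply, conjL_toL, scale_conj, σ.tail_inl]
    rfl

lemma ycoord_conj (w : V) (l : L) :
    Γ.ycoord (σ.conjParams conjP p) w l = conjL (Γ.ycoord p (σ.sV w) (σ.sL l)) := by
  simp only [TropCurve.ycoord, scale_conj, center_conj, σ.tail_inr, conjParams_beta_inr,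
    ← conjL_toL]
  simp only [← conjLHom_apply, map_div₀, map_sub, map_add, map_mul]

lemma slope_sL_eq (l : L) : Γ.slope (Sum.inr (σ.sL l)) = Γ.slope (Sum.inr l) :=
  σ.slope_comm (Sum.inr l)

lemma phiEdge_conj (b : B) (i : Fin 2) :
    Γ.phiEdge (σ.conjParams conjP p) b i = conjL (Γ.phiEdge p (σ.sB b) i) := by
  rw [← conjLHom_apply, TropCurve.phiEdge, TropCurve.phiEdge, map_mul, map_prod, map_prod]
  refine congrArg₂ (· * ·) ?_ ?_
  · refine Finset.prod_nbij' σ.sL σ.sL ?_ ?_ (fun l _ => σ.sL_sL l) (fun l _ => σ.sL_sL l) ?_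
    · intro l hl
      simpa [σ.tail_inl, σ.head_comm, σ.above_iff] using hl
    · intro l hl
      rw [← σ.sL_sL l] at hl
      simpa [σ.tail_inl, σ.head_comm, σ.above_iff] using hl
    · intro l _
      rw [map_zpow₀, map_sub, ycoord_conj, conjLHom_apply, conjLHom_apply, conjL_toL, σ.tail_inl,
        slope_sL_eq]
      rfl
  · refine Finset.prod_nbij' σ.sL σ.sL ?_ ?_ (fun l _ => σ.sL_sL l) (fun l _ => σ.sL_sL l) ?_
    · intro l hl
      simpa [σ.tail_inl, σ.above_iff] using hl
    · intro l hl
      rw [← σ.sL_sL l] at hl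
      simpa [σ.tail_inl, σ.above_iff] using hl
    · intro l _
      rw [map_zpow₀, map_sub, map_one, map_div₀, ycoord_conj, conjLHom_apply, conjLHom_apply,
        conjL_toL, σ.tail_inl, slope_sL_eq]
      rfl

lemma phiEnd_conj (j : L) :
    Γ.phiEnd (σ.conjParams conjP p) j = conjL (Γ.phiEnd p (σ.sL j)) := by
  rw [← conjLHom_apply, TropCurve.phiEnd, TropCurve.phiEnd, map_mul, map_mul, map_prod, map_prod]
  refine congrArg₂ (· * ·) ?_ ?_
  · refine congrArg₂ (· * ·) ?_ ?_
    · refine Finset.prod_nbij' σ.sL σ.sL ?_ ?_ (fun l _ => σ.sL_sL l) (fun l _ => σ.sL_sL l) ?_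
      · intro l hl
        simpa [σ.tail_inr, σ.above_iff] using hl
      · intro l hl
        rw [← σ.sL_sL l] at hl
        simpa [σ.tail_inr, σ.above_iff] using hl
      · intro l _
        rw [map_zpow₀, map_sub, ycoord_conj, conjLHom_apply, conjLHom_apply, conjL_toL, σ.tail_inr,
          slope_sL_eq, slope_sL_eq]
        rfl
    · refine Finset.prod_nbij' σ.sL σ.sL ?_ ?_ (fun l _ => σ.sL_sL l) (fun l _ => σ.sL_sL l) ?_
      · intro l hl
        simpa [σ.tail_inr, σ.above_iff] using hl
      · intro l hl
        rw [← σ.sL_sL l] at hl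
        simpa [σ.tail_inr, σ.above_iff] using hl
      · intro l _
        rw [map_zpow₀, map_sub, map_one, map_div₀, ycoord_conj, conjLHom_apply, conjLHom_apply,
          conjL_toL, σ.tail_inr, slope_sL_eq, slope_sL_eq]
        rfl
  · rw [map_zpow₀, map_neg, map_one, slope_sL_eq]

/-- `Θ` commutes with the conjugation. -/
lemma theta_conj :
    Γ.theta (σ.conjParams conjP p) = σ.conjTarget conjL (Γ.theta p) := by
  refine Prod.ext ?_ ?_
  · funext b i
    change _ = conjL ((Γ.theta p).1 (σ.sB b) i)
    have := σ.slope_comm (Sum.inl b)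
    rw [Sum.map_inl] at this
    rw [← conjLHom_apply, TropCurve.theta, TropCurve.theta]
    simp only [map_mul, map_div₀, map_zpow₀, conjLHom_apply, conjL_toL, phiEdge_conj, this,
      σ.tail_inl, σ.head_comm]
    rfl
  · funext j
    change _ = conjL ((Γ.theta p).2 (σ.sL j))
    rw [← conjLHom_apply, TropCurve.theta, TropCurve.theta]
    simp only [map_mul, map_zpow₀, conjLHom_apply, conjL_toL, phiEnd_conj, slope_sL_eq, σ.tail_inr]
    rfl

lemma thetaZero_conj (c : Params V B L ℂ) :
    Γ.thetaZero (σ.conjParams (starRingEnd ℂ) c) =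
      σ.conjTarget (starRingEnd ℂ) (Γ.thetaZero c) := by
  have h := σ.theta_conj ((fun v i => PowerSeries.C (c.1 v i), fun b => PowerSeries.C (c.2.1 b),
    fun e => PowerSeries.C (c.2.2 e)) : Params V B L ℂ⟦X⟧)
  simp only [conjParams, conjP_C] at h
  refine Prod.ext ?_ ?_
  · funext b i
    exact congrArg (fun r => (r.1 b i).coeff 0) h
  · funext j
    exact congrArg (fun r => (r.2 j).coeff 0) h

lemma modT_conj : Params.modT (σ.conjParams conjP p) =
    σ.conjParams (starRingEnd ℂ) (Params.modT p) := by
  refine Prod.ext ?_ (Prod.ext ?_ ?_)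
  · funext v i
    exact constantCoeff_conjP _
  · funext b
    exact constantCoeff_conjP _
  · funext e
    exact constantCoeff_conjP _

end RealStructure

section Flatten

variable {V B L : Type}

/-- The coordinates of the points of `Params V B L R`. -/
abbrev ParamIndex (V B L : Type) : Type := (V × Fin 2) ⊕ B ⊕ (B ⊕ L)

/-- The point of `Params V B L R` with given coordinates. -/
def Params.ofCoords {R : Type} (x : ParamIndex V B L → R) : Params V B L R :=
  (fun v i => x (.inl (v, i)), fun b => x (.inr (.inl b)), fun e => x (.inr (.inr e)))

/-- The coordinates of a point of `Params V B L R`. -/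
def Params.coords {R : Type} (p : Params V B L R) : ParamIndex V B L → R :=
  Sum.elim (fun v => p.1 v.1 v.2) (Sum.elim p.2.1 p.2.2)

lemma Params.ofCoords_coords {R : Type} (p : Params V B L R) : ofCoords p.coords = p := rfl

lemma Params.coords_ofCoords {R : Type} (x : ParamIndex V B L → R) : (ofCoords x).coords = x := by
  funext i
  rcases i with _ | _ | _ <;> rfl

/-- The coordinates of a point of `Target B L R`. -/
def Target.coords {R : Type} (r : Target B L R) : (B × Fin 2) ⊕ L → R :=
  Sum.elim (fun b => r.1 b.1 b.2) r.2

lemma Target.coords_inl {R : Type} (r : Target B L R) (b : B) (i : Fin 2) :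
    r.coords (.inl (b, i)) = r.1 b i := rfl

lemma Target.coords_inr {R : Type} (r : Target B L R) (l : L) : r.coords (.inr l) = r.2 l := rfl

lemma Target.coords_mul (r r' : Target B L ℂ) (k : (B × Fin 2) ⊕ L) :
    (r * r').coords k = r.coords k * r'.coords k := by
  rcases k with _ | _ <;> rfl

lemma Target.coords_injective {R : Type} :
    Function.Injective (Target.coords : Target B L R → _) := fun _ _ h =>
  Prod.ext (funext fun b => funext fun i => congrFun h (.inl (b, i)))
    (funext fun l => congrFun h (.inr l))

lemma Target.exists_coords {R : Type} (y : (B × Fin 2) ⊕ L → R) :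
    ∃ r : Target B L R, r.coords = y :=
  ⟨(fun b i => y (.inl (b, i)), fun l => y (.inr l)), by funext i; rcases i with _ | _ <;> rfl⟩

end Flatten

/-- The power series with the same coefficients as a Laurent series. -/
def regularPart (F : LaurentSeries ℂ) : ℂ⟦X⟧ := PowerSeries.mk fun n => F.coeff n

lemma regularPart_toL (f : ℂ⟦X⟧) : regularPart (toL f) = f := by
  ext n
  rw [regularPart, PowerSeries.coeff_mk, toL_coeff, if_neg (by omega), Int.natAbs_natCast]

lemma TropCurve.jetParams {V B L : Type} (n : ℕ) (p q : ParamIndex V B L → ℂ⟦X⟧) :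
    JetParams n (Params.ofCoords p) (Params.ofCoords fun i => p i + PowerSeries.X ^ n * q i)
      (Params.ofCoords fun i => PowerSeries.constantCoeff (p i))
      (Params.ofCoords fun i => PowerSeries.constantCoeff (q i)) := by
  refine ⟨fun v i => ?_, fun b => ?_, fun e => ?_⟩ <;> exact ⟨_, _, rfl, rfl, rfl, rfl⟩

variable {V B L : Type} [Fintype B] [Fintype L] {Γ : TropCurve V B L}
  {σ : RealStructure Γ}

lemma TropCurve.JetParams.theta_coords [Fintype V] {n : ℕ} (hn : 0 < n) {p p' : Params V B L ℂ⟦X⟧}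
    {c d : Params V B L ℂ} (hc : Γ.Regular c) (h : JetParams n p p' c d)
    (k : (B × Fin 2) ⊕ L) :
    Jet n ((Γ.theta p).coords k) ((Γ.theta p').coords k) ((Γ.lead c).coords k)
      ((Γ.lead c * Γ.logDiff c d).coords k) := by
  rw [Target.coords_mul]
  rcases k with ⟨b, i⟩ | j
  · simp only [Target.coords_inl]
    exact (h.theta_edge hn hc b i).2
  · simp only [Target.coords_inr]
    exact (h.theta_end hn hc j).2

lemma RealStructure.Simple.logDiff_bijective [Fintype V] (h : σ.Simple) (hinj : Function.Injective Γ.momentMap)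
    (hsurj : ∀ R : L → ℂ, (∀ j, R (σ.sL j) = R j) → ∃ y, Γ.momentMap y = R)
    {c : Params V B L ℂ} (hc : Γ.Regular c) :
    (∀ d : Params V B L ℂ, (∀ e, ¬ σ.Free e → d.2.2 e = 0) → Γ.lead c * Γ.logDiff c d = 0 → d = 0) ∧
    ∀ R : Target B L ℂ, ∃ d : Params V B L ℂ, (∀ e, ¬ σ.Free e → d.2.2 e = 0) ∧
      Γ.lead c * Γ.logDiff c d = R := by
  refine ⟨fun d hd h0 => h.eq_zero_of_logDiff_eq_zero hinj hc hd (Prod.ext ?_ ?_), fun R => ?_⟩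
  · funext b i
    exact (mul_eq_zero.1 (congrFun (congrFun (congrArg Prod.fst h0) b) i)).resolve_left
      (hc.lead_ne.1 b i)
  · funext j
    exact (mul_eq_zero.1 (congrFun (congrArg Prod.snd h0) j)).resolve_left (hc.lead_ne.2 j)
  · obtain ⟨d, hd, hR⟩ := h.exists_logDiff_eq hsurj hc
      (fun b i => R.1 b i / (Γ.lead c).1 b i, fun j => R.2 j / (Γ.lead c).2 j)
    refine ⟨d, hd, ?_⟩
    rw [hR]
    refine Prod.ext ?_ ?_
    · funext b i
      exact mul_div_cancel₀ _ (hc.lead_ne.1 b i)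
    · funext j
      exact mul_div_cancel₀ _ (hc.lead_ne.2 j)

namespace Marking

variable {m : Marking σ} {p : Params V B L ℂ⟦X⟧}

lemma InSpace.regular (hp : m.InSpace p) : Γ.Regular (Params.modT p) := by
  have key : ∀ f : ℂ⟦X⟧, IsUnit f → PowerSeries.constantCoeff f ≠ 0 := fun f hf =>
    (PowerSeries.isUnit_iff_constantCoeff.1 hf).ne_zero
  refine ⟨fun v i => key _ (hp.chi_unit v i), fun b => key _ (hp.alpha_unit b),
    fun e e' h h' => ?_⟩
  have := key _ (hp.beta_sub_unit e e' h h')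
  rw [map_sub] at this
  exact sub_ne_zero.1 this

lemma InSpace.conj_eq (hp : m.InSpace p) : σ.conjParams conjP p = p := by
  refine Prod.ext ?_ (Prod.ext ?_ ?_)
  · funext v i
    exact (congrArg conjP (hp.chi_real v i)).trans (conjP_conjP _)
  · funext b
    exact (congrArg conjP (hp.alpha_real b)).trans (conjP_conjP _)
  · funext e
    exact (congrArg conjP (hp.beta_real e)).trans (conjP_conjP _)

lemma inSpace_of_conj_eq (hreg : Γ.Regular (Params.modT p)) (hconj : σ.conjParams conjP p = p)
    (hnorm : ∀ e c, m.Normalized e c → p.2.2 e = PowerSeries.C c) : m.InSpace p := by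
  have key : ∀ f : ℂ⟦X⟧, PowerSeries.constantCoeff f ≠ 0 → IsUnit f := fun f hf =>
    PowerSeries.isUnit_iff_constantCoeff.2 (isUnit_iff_ne_zero.2 hf)
  have conj_of : ∀ f g : ℂ⟦X⟧, conjP f = g → f = conjP g := fun f g h => by
    rw [← h, conjP_conjP]
  refine ⟨fun v i => key _ (hreg.chi_ne v i), fun v i => ?_, fun b => key _ (hreg.alpha_ne b),
    fun b => ?_, fun e e' h h' => key _ ?_, fun e => ?_, hnorm⟩
  · exact conj_of _ _ (congrFun (congrFun (congrArg Prod.fst hconj) v) i)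
  · exact conj_of _ _ (congrFun (congrArg (fun q => q.2.1) hconj) b)
  · rw [map_sub]
    exact sub_ne_zero.2 (hreg.beta_ne e e' h h')
  · exact conj_of _ _ (congrFun (congrArg (fun q => q.2.2) hconj) e)

end Marking

namespace RealStructure

variable (σ)

/-- The conjugation on families of complex parameters, as a real linear map. -/
def conjParamsL [Fintype V] : Params V B L ℂ →L[ℝ] Params V B L ℂ :=
  LinearMap.toContinuousLinearMap
    { toFun := σ.conjParams (starRingEnd ℂ)
      map_add' := fun x y => by
        refine Prod.ext ?_ (Prod.ext ?_ ?_) <;> simp [conjParams] <;> rfl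
      map_smul' := fun r x => by
        refine Prod.ext ?_ (Prod.ext ?_ ?_) <;> simp [conjParams] <;> rfl }

/-- The conjugation on the target of `Θ` mod `t`, as a real linear map. -/
def conjTargetL : Target B L ℂ →L[ℝ] Target B L ℂ :=
  LinearMap.toContinuousLinearMap
    { toFun := σ.conjTarget (starRingEnd ℂ)
      map_add' := fun x y => by
        refine Prod.ext ?_ ?_ <;> simp [conjTarget] <;> rfl
      map_smul' := fun r x => by
        refine Prod.ext ?_ ?_ <;> simp [conjTarget] <;> rfl }

variable {σ}

lemma conjParamsL_apply [Fintype V] (d : Params V B L ℂ) :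
    σ.conjParamsL d = σ.conjParams (starRingEnd ℂ) d := rfl

lemma conjTargetL_apply (r : Target B L ℂ) :
    σ.conjTargetL r = σ.conjTarget (starRingEnd ℂ) r := rfl

lemma fderiv_conj [Fintype V] {D : Params V B L ℂ →L[ℝ] Target B L ℂ} {c : Params V B L ℂ}
    (hD : HasFDerivAt Γ.thetaZero D c) (hc : σ.conjParams (starRingEnd ℂ) c = c)
    (d : Params V B L ℂ) :
    D (σ.conjParams (starRingEnd ℂ) d) = σ.conjTarget (starRingEnd ℂ) (D d) := by
  have hD' : HasFDerivAt Γ.thetaZero D (σ.conjParamsL c) := by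
    rwa [conjParamsL_apply, hc]
  have h1 : HasFDerivAt (Γ.thetaZero ∘ σ.conjParamsL) (D.comp σ.conjParamsL) c :=
    hD'.comp c σ.conjParamsL.hasFDerivAt
  have h2 : HasFDerivAt (σ.conjTargetL ∘ Γ.thetaZero) (σ.conjTargetL.comp D) c :=
    σ.conjTargetL.hasFDerivAt.comp c hD
  have h3 : Γ.thetaZero ∘ σ.conjParamsL = σ.conjTargetL ∘ Γ.thetaZero :=
    funext fun c => by
      rw [Function.comp_apply, Function.comp_apply, conjParamsL_apply, conjTargetL_apply,
        σ.thetaZero_conj]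
  rw [h3] at h1
  have h4 := DFunLike.congr_fun (h1.unique h2) d
  rwa [ContinuousLinearMap.comp_apply, ContinuousLinearMap.comp_apply, conjParamsL_apply,
    conjTargetL_apply] at h4

end RealStructure

lemma Marking.mem_tangent_iff {m : Marking σ} (h : σ.Simple) (d : Params V B L ℂ) :
    d ∈ m.tangent ↔ σ.conjParams (starRingEnd ℂ) d = d ∧ ∀ e, ¬ σ.Free e → d.2.2 e = 0 := by
  have conj_iff : ∀ x y : ℂ, x = starRingEnd ℂ y ↔ starRingEnd ℂ x = y := fun x y =>
    ⟨fun h => by rw [h, Complex.conj_conj], fun h => by rw [← h, Complex.conj_conj]⟩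
  have hn : (∀ e c, m.Normalized e c → d.2.2 e = 0) ↔ ∀ e, ¬ σ.Free e → d.2.2 e = 0 :=
    forall_congr' fun e => by rw [← Marking.exists_normalized_iff (m := m) h e, forall_exists_index]
  change ((∀ v i, d.1 (σ.sV v) i = starRingEnd ℂ (d.1 v i)) ∧
    (∀ b, d.2.1 (σ.sB b) = starRingEnd ℂ (d.2.1 b)) ∧
    (∀ e, d.2.2 (σ.sE e) = starRingEnd ℂ (d.2.2 e)) ∧
    ∀ e c, m.Normalized e c → d.2.2 e = 0) ↔ _
  rw [hn]
  simp only [conj_iff, RealStructure.conjParams, Prod.ext_iff, funext_iff, and_assoc]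

lemma RealStructure.mem_targetTangent_iff (r : Target B L ℂ) :
    r ∈ σ.targetTangent ↔ σ.conjTarget (starRingEnd ℂ) r = r := by
  have conj_iff : ∀ x y : ℂ, x = starRingEnd ℂ y ↔ starRingEnd ℂ x = y := fun x y =>
    ⟨fun h => by rw [h, Complex.conj_conj], fun h => by rw [← h, Complex.conj_conj]⟩
  change ((∀ b i, r.1 (σ.sB b) i = starRingEnd ℂ (r.1 b i)) ∧
    ∀ l, r.2 (σ.sL l) = starRingEnd ℂ (r.2 l)) ↔ _
  simp only [conj_iff, RealStructure.conjTarget, Prod.ext_iff, funext_iff]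

lemma RealStructure.free_of_free_sE {e : B ⊕ L} (he : σ.Free (σ.sE e)) :
    σ.Free e := by
  have h1 : σ.sE e = e := by rw [← he.1, σ.sE_sE]
  rwa [h1] at he

lemma jacobianInvertible [Fintype V] (h : σ.Simple) (hinj : Function.Injective Γ.momentMap)
    (hsurj : ∀ R : L → ℂ, (∀ j, R (σ.sL j) = R j) → ∃ y, Γ.momentMap y = R)
    {m : Marking σ} {p : Params V B L ℂ⟦X⟧} (hp : m.InSpace p) : JacobianInvertible m p := by
  have hc := hp.regular
  have hconj : σ.conjParams (starRingEnd ℂ) (Params.modT p) = Params.modT p := by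
    rw [← σ.modT_conj, hp.conj_eq]
  obtain ⟨D, hD, hDd⟩ := TropCurve.exists_hasFDerivAt_thetaZero hc
  obtain ⟨hb, hb'⟩ := h.logDiff_bijective hinj hsurj hc
  have hDR : HasFDerivAt Γ.thetaZero (D.restrictScalars ℝ) (Params.modT p) :=
    hD.restrictScalars ℝ
  have hcomm := RealStructure.fderiv_conj hDR hconj
  have hker : ∀ d d' : Params V B L ℂ, (∀ e, ¬ σ.Free e → d.2.2 e = 0) →
      (∀ e, ¬ σ.Free e → d'.2.2 e = 0) → D d = D d' → d = d' := by
    intro d d' h1 h2 h3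
    refine sub_eq_zero.1 (hb _ (fun e he => ?_) ?_)
    · change d.2.2 e - d'.2.2 e = 0
      rw [h1 e he, h2 e he, sub_zero]
    · rw [← hDd, map_sub, h3, sub_self]
  refine ⟨D.restrictScalars ℝ, hDR, fun d hd => ?_, fun d hd d' hd' hdd => ?_, fun r hr => ?_⟩
  · rw [SetLike.mem_coe, Marking.mem_tangent_iff h] at hd
    rw [SetLike.mem_coe, RealStructure.mem_targetTangent_iff, ← hcomm, hd.1]
  · rw [SetLike.mem_coe, Marking.mem_tangent_iff h] at hd hd'
    exact hker d d' hd.2 hd'.2 hdd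
  · rw [SetLike.mem_coe, RealStructure.mem_targetTangent_iff] at hr
    obtain ⟨d, hd, hdr⟩ := hb' r
    rw [← hDd] at hdr
    refine ⟨d, ?_, hdr⟩
    rw [SetLike.mem_coe, Marking.mem_tangent_iff h]
    refine ⟨hker _ _ (fun e he => ?_) hd ?_, hd⟩
    · change starRingEnd ℂ (d.2.2 (σ.sE e)) = 0
      rw [hd _ fun he' => he (RealStructure.free_of_free_sE he'), map_zero]
    · have := hcomm d
      change D _ = σ.conjTarget (starRingEnd ℂ) (D d) at this
      rw [this, hdr, hr]

/-- The complex version of the correspondence: a first order solution of `Θ = τ` lifts to a unique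
solution with prescribed values of `β` on the edges that are not free. -/
lemma existsUnique_theta_eq [Fintype V] (h : σ.Simple) (hinj : Function.Injective Γ.momentMap)
    (hsurj : ∀ R : L → ℂ, (∀ j, R (σ.sL j) = R j) → ∃ y, Γ.momentMap y = R)
    {p₀ : Params V B L ℂ⟦X⟧} (hc : Γ.Regular (Params.modT p₀)) (τ : Target B L ℂ⟦X⟧)
    (hτ : ∀ k, EqModT ((Γ.theta p₀).coords k) (toL (τ.coords k))) :
    ∃! p : Params V B L ℂ⟦X⟧, Params.modT p = Params.modT p₀ ∧
      (∀ e, ¬ σ.Free e → p.2.2 e = p₀.2.2 e) ∧ ∀ k, (Γ.theta p).coords k = toL (τ.coords k) := by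
  obtain ⟨hb, hb'⟩ := h.logDiff_bijective hinj hsurj hc
  have hmod : ∀ x : ParamIndex V B L → ℂ⟦X⟧, Params.modT (Params.ofCoords x) =
      Params.ofCoords fun i => PowerSeries.constantCoeff (x i) := fun x => rfl
  have hmod_iff : ∀ x : ParamIndex V B L → ℂ⟦X⟧,
      (∀ i, PowerSeries.constantCoeff (x i) = PowerSeries.constantCoeff (p₀.coords i)) ↔
        Params.modT (Params.ofCoords x) = Params.modT p₀ := by
    intro x
    rw [← funext_iff]
    constructor
    · intro hx
      rw [hmod, hx]
      rfl
    · intro hx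
      have := congrArg Params.coords hx
      rw [hmod, Params.coords_ofCoords] at this
      rw [this]
      exact Params.coords_ofCoords fun i => PowerSeries.constantCoeff (p₀.coords i)
  have hjet : ∀ n, 0 < n → ∀ x y : ParamIndex V B L → ℂ⟦X⟧,
      Params.modT (Params.ofCoords x) = Params.modT p₀ → ∀ k,
      Jet n ((Γ.theta (Params.ofCoords x)).coords k)
        ((Γ.theta (Params.ofCoords fun i => x i + PowerSeries.X ^ n * y i)).coords k)
        ((Γ.lead (Params.modT p₀)).coords k)
        ((Γ.lead (Params.modT p₀) * Γ.logDiff (Params.modT p₀)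
          (Params.ofCoords fun i => PowerSeries.constantCoeff (y i))).coords k) := by
    intro n hn x y hx k
    have := TropCurve.jetParams n x y
    rw [← hmod, hx] at this
    exact this.theta_coords hn hc k
  have hreg : ∀ x : ParamIndex V B L → ℂ⟦X⟧,
      Params.modT (Params.ofCoords x) = Params.modT p₀ → ∀ k,
      toL (regularPart ((Γ.theta (Params.ofCoords x)).coords k)) =
        (Γ.theta (Params.ofCoords x)).coords k := by
    intro x hx k
    obtain ⟨f, -, hf, -⟩ := hjet 1 one_pos x 0 hx k
    rw [hf, regularPart_toL]
  have key := existsUnique_power_series_solution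
    (fun x k => regularPart ((Γ.theta (Params.ofCoords x)).coords k))
    (fun d => (Γ.lead (Params.modT p₀) *
      Γ.logDiff (Params.modT p₀) (Params.ofCoords d)).coords)
    {i | ∃ e, ¬ σ.Free e ∧ i = .inr (.inr e)} p₀.coords ?_ ?_ ?_ τ.coords ?_
  · obtain ⟨x, ⟨hx1, hx2, hx3⟩, hx4⟩ := key
    have hx1' := (hmod_iff x).1 hx1
    refine ⟨Params.ofCoords x, ⟨hx1', fun e he => hx2 _ ⟨e, he, rfl⟩, fun k => ?_⟩, ?_⟩
    · rw [← hreg x hx1']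
      exact congrArg toL (congrFun hx3 k)
    · rintro p ⟨hp1, hp2, hp3⟩
      have := hx4 p.coords ⟨(hmod_iff _).2 hp1, ?_, ?_⟩
      · rw [← this, Params.ofCoords_coords]
      · rintro _ ⟨e, he, rfl⟩
        exact hp2 e he
      · funext k
        rw [Params.ofCoords_coords, hp3, regularPart_toL]
  · intro n hn x y hx
    choose f g h1 h2 h3 h4 using hjet n hn x y ((hmod_iff x).1 hx)
    refine ⟨g, funext fun k => ?_, fun k => h4 k⟩
    rw [h1, h2, regularPart_toL, regularPart_toL]
  · intro d hd h0
    have h1 := hb (Params.ofCoords d) (fun e he => hd _ ⟨e, he, rfl⟩) (Target.coords_injective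
      (h0.trans (by funext k; rcases k with _ | _ <;> rfl)))
    have h2 := congrArg Params.coords h1
    rw [Params.coords_ofCoords] at h2
    rw [h2]
    funext i
    rcases i with _ | _ | _ <;> rfl
  · intro r
    obtain ⟨R, rfl⟩ := Target.exists_coords r
    obtain ⟨d, hd, hR⟩ := hb' R
    refine ⟨d.coords, ?_, ?_⟩
    · rintro _ ⟨e, he, rfl⟩
      exact hd e he
    · rw [Params.ofCoords_coords, hR]
  · intro k
    have h1 := hτ k 0 le_rfl
    rw [← PowerSeries.coeff_zero_eq_constantCoeff_apply, regularPart, PowerSeries.coeff_mk]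
    rw [HahnSeries.coeff_sub, toL_coeff_zero] at h1
    exact sub_eq_zero.1 h1

lemma Marking.InSpace.existsUnique_solution [Fintype V] (h : σ.Simple)
    (hinj : Function.Injective Γ.momentMap)
    (hsurj : ∀ R : L → ℂ, (∀ j, R (σ.sL j) = R j) → ∃ y, Γ.momentMap y = R)
    {m : Marking σ} {p₀ : Params V B L ℂ⟦X⟧} (hp₀ : m.InSpace p₀) {ζ : L → LaurentSeries ℂ}
    (hζ : ∀ l, ζ (σ.sL l) = conjL (ζ l)) (hsol : IsFirstOrderSolution Γ ζ p₀) :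
    ∃! p : Params V B L ℂ⟦X⟧,
      m.InSpace p ∧ Params.modT p = Params.modT p₀ ∧ IsSolution Γ ζ p := by
  let τ : Target B L ℂ⟦X⟧ := (fun _ _ => 1, fun l => (ζ l).powerSeriesPart)
  have hτ1 : toL 1 = 1 := map_one (HahnSeries.ofPowerSeries ℤ ℂ)
  have hτ2 : ∀ l, toL (ζ l).powerSeriesPart = normMoment (ζ l) := fun l =>
    LaurentSeries.ofPowerSeries_powerSeriesPart (ζ l)
  have hiff : ∀ p, IsSolution Γ ζ p ↔ ∀ k, (Γ.theta p).coords k = toL (τ.coords k) := by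
    intro p
    constructor
    · rintro ⟨h1, h2⟩ (⟨b, i⟩ | l)
      · rw [Target.coords_inl, h1, Target.coords_inl, hτ1]
      · rw [Target.coords_inr, h2, Target.coords_inr, hτ2]
    · refine fun hk => ⟨fun b i => ?_, fun l => ?_⟩
      · rw [← Target.coords_inl, hk, Target.coords_inl, hτ1]
      · rw [← Target.coords_inr, hk, Target.coords_inr, hτ2]
  obtain ⟨p, ⟨hp1, hp2, hp3⟩, hp4⟩ := existsUnique_theta_eq h hinj hsurj hp₀.regular τ (by
    rintro (⟨b, i⟩ | l)
    · rw [Target.coords_inl, Target.coords_inl, hτ1]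
      exact hsol.1 b i
    · rw [Target.coords_inr, Target.coords_inr, hτ2]
      exact hsol.2 l)
  have hps : IsSolution Γ ζ p := (hiff p).2 hp3
  have hconj₀ := hp₀.conj_eq
  have hconj : σ.conjParams conjP p = p := by
    refine hp4 _ ⟨?_, fun e he => ?_, (hiff _).1 ?_⟩
    · rw [σ.modT_conj, hp1, ← σ.modT_conj, hconj₀]
    · have := congrFun (congrArg (fun q => q.2.2) hconj₀) e
      change conjP (p₀.2.2 (σ.sE e)) = _ at this
      rw [← this, ← hp2 _ fun he' => he (RealStructure.free_of_free_sE he')]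
      rfl
    · rw [IsSolution, σ.theta_conj]
      refine ⟨fun b i => ?_, fun l => ?_⟩
      · change conjL ((Γ.theta p).1 (σ.sB b) i) = 1
        rw [hps.1, ← conjLHom_apply, map_one]
      · change conjL ((Γ.theta p).2 (σ.sL l)) = _
        rw [hps.2, ← normMoment_conjL, hζ, conjL_conjL]
  refine ⟨p, ⟨Marking.inSpace_of_conj_eq (hp1 ▸ hp₀.regular) hconj fun e c hec => ?_, hp1, hps⟩, ?_⟩
  · rw [hp2 e ((Marking.exists_normalized_iff h e).1 ⟨c, hec⟩), hp₀.beta_norm e c hec]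
  · rintro p' ⟨hp', hmod, hsol'⟩
    refine hp4 p' ⟨hmod, fun e he => ?_, (hiff p').1 hsol'⟩
    obtain ⟨c, hec⟩ := (Marking.exists_normalized_iff (m := m) h e).2 he
    rw [hp'.beta_norm e c hec, hp₀.beta_norm e c hec]

end

theorem theorem5p1
    (Δ : Multiset LatN) (hprim : ∀ n ∈ Δ, IsPrimitive n) (hsum : Δ.sum = 0)
    (n₁ : LatN) (s : ℕ) (hs : 2 * s ≤ Δ.count n₁)
    (L₀ : Type) [Fintype L₀] (ν : L₀ → LatN) (νr : LatN)
    (hν : νr ::ₘ (Finset.univ : Finset L₀).val.map ν = doubledDegree Δ n₁ s) :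
    ∃ H : Finset (L₀ → ℤ), 0 ∉ H ∧
      ∀ μ : L₀ → ℤ, (∀ c ∈ H, ∑ j, c j * μ j ≠ 0) →
      ∀ (V₀ B₀ : Type) [Fintype V₀] [Fintype B₀] (Γ₀ : TropCurve V₀ B₀ L₀),
      Γ₀.rootSlope = νr → (∀ j, Γ₀.slope (Sum.inr j) = ν j) →
      (∀ j, Γ₀.moment j = μ j) →
      ∀ (V B L : Type) [Fintype V] [Fintype B] [Fintype L] (Γ : TropCurve V B L)
        (σ : RealStructure Γ) (π : Splitting Γ σ Γ₀),
      Γ.degree = Δ → Γ.NoFlat →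
      ∀ (m : Marking σ) (ζ : L → LaurentSeries ℂ), IsMomentFamily σ ζ →
      (∀ l, σ.sL l = l → μ (π.pL l) = (ζ l).order) →
      (∀ l, σ.sL l ≠ l → μ (π.pL l) = 2 * (ζ l).order) →
      ∀ p₀ : Params V B L (PowerSeries ℂ), m.InSpace p₀ → IsFirstOrderSolution Γ ζ p₀ →
        JacobianInvertible m p₀ ∧
        ∃! p : Params V B L (PowerSeries ℂ),
          m.InSpace p ∧ Params.modT p = Params.modT p₀ ∧ IsSolution Γ ζ p := by
  refine ⟨genericForms ν, zero_notMem_genericForms ν, ?_⟩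
  intro μ hμ V₀ B₀ _ _ Γ₀ _ hslope hmoment V B L _ _ _ Γ σ π _ hflat m ζ hζ _ _ p₀ hp₀ hsol
  obtain rfl : (fun j => Γ₀.slope (Sum.inr j)) = ν := funext hslope
  obtain rfl : Γ₀.moment = μ := funext hmoment
  have hsurj₀ := TropCurve.momentMap_surjective hμ
  have hinj₀ := (TropCurve.momentMap_bijective hsurj₀).1
  have hn₁ : ∀ l, σ.sL l ≠ l → Γ.slope (Sum.inr l) = n₁ := by
    intro l hl
    refine two_nsmul_mem_doubledDegree hprim (s := s) ?_
    have h1 := π.slope_complex (Sum.inr l) fun h => hl (Sum.inr_injective h)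
    rw [← h1, ← hν]
    exact Multiset.mem_cons_of_mem (Multiset.mem_map_of_mem _ (Finset.mem_univ_val (π.pL l)))
  have h := π.simple hn₁ hflat (Γ₀.card_out_eq_two (TropCurve.card_ends_le hsurj₀))
  have hinj := π.momentMap_injective h.sB_eq hinj₀
  have hsurj := π.exists_momentMap_eq h.sB_eq hsurj₀
  exact ⟨jacobianInvertible h hinj hsurj hp₀,
    hp₀.existsUnique_solution h hinj hsurj hζ.conj hsol⟩
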